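/- **Theorem (convergence of the MoLDD scheme).** *Setting.* Let $d\in\{2,3\}$, let $\Omega\subset\mathbb R^d$ be a bounded open set and let $\gamma\subset\Omega$ be a flat fracture, i.e. a relatively open subset of a hyperplane, identified with an open subset of $\mathbb R^{d-1}$, such that $\Omega=\Omega_1\cup\Omega_2\cup\gamma$ with disjoint open sets $\Omega_1,\Omega_2$ and $\gamma=\partial\Omega_1\cap\partial\Omega_2\cap\Omega$. Let $\mathbf n_i$ be the outward unit normal of $\Omega_i$. Let $\mathcal T_{h,1},\mathcal T_{h,2}$ be finite partitions of $\overline\Omega_1,\overline\Omega_2$ into simplices or rectangular elements which together are conforming, and let $\mathcal T_{h,\gamma}$ be such a partition of $\overline\gamma$ (not necessarily matching the other two). Let $M_{h,i}\subset L^2(\Omega_i)$ and $M_{h,\gamma}\subset L^2(\gamma)$ be the spaces of piecewise constants, and let $\mathbf V_{h,i}\subset\{\mathbf v\in \mathbf H(\mathrm{div},\Omega_i):\mathbf v\cdot\mathbf n_i\in L^2(\gamma)\}$ and $\mathbf V_{h,\gamma}\subset \mathbf H(\mathrm{div}_\tau,\gamma)$ be the lowest-order Raviart–Thomas–Nédélec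 spaces on these meshes. *Data.* Consider one time step of length $\tau>0$. Let $\alpha_\gamma>0$, $f_i,p_i^{\rm prev}\in L^2(\Omega_i)$, $f_\gamma,\lambda^{\rm prev}\in L^2(\gamma)$ (source terms on the time interval, and pressures at the previous time level). Let $\mathbf K$ on $\Omega_1\cup\Omega_2$ and $\mathbf K_\gamma$ on $\gamma$ be measurable matrix fields such that, for a.e. $x$ and all $z$, $z^T\mathbf K^{-1}(x)z\ge c_{\mathbf K}|z|^2$, $|\mathbf K^{-1}(x)z|\le C_{\mathbf K}|z|$, $z^T\mathbf K_\gamma^{-1}(x)z\ge c_{\mathbf K,\gamma}|z|^2$, $|\mathbf K_\gamma^{-1}(x)z|\le C_{\mathbf K,\gamma}|z|$, with $c_{\mathbf K},c_{\mathbf K,\gamma}>0$. Let $\xi:\mathbb R^{d-1}\to\mathbb R^{d-1}$ be of class $C^1$ with symmetric Jacobian matrix $\xi'$ (for $d=2$: any scalar $C^1$ function; for $d=3$ this covers a scalar law applied componentwise and radial laws), and let $L_\xi>0$. *Forms.* Put $a_i(\mathbf u,\mathbf v)=(\mathbf K^{-1}\mathbf u,\mathbf v)_{\Omega_i}+\alpha_\gamma^{-1}(\mathbf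 u\cdot\mathbf n_i,\mathbf v\cdot\mathbf n_i)_\gamma$, $b_i(\mathbf u,q)=(\nabla\cdot\mathbf u,q)_{\Omega_i}$, $a_\gamma(\mathbf u,\mathbf v)=(\mathbf K_\gamma^{-1}\mathbf u,\mathbf v)_\gamma$, $b_\gamma(\mathbf u,\mu)=(\nabla_\tau\cdot\mathbf u,\mu)_\gamma$. For $\lambda\in L^2(\gamma)$ and $r\in L^2(\Omega_i)$ consider the subdomain problem: find $(\mathbf u,p)\in\mathbf V_{h,i}\times M_{h,i}$ with $$a_i(\mathbf u,\mathbf v)-b_i(\mathbf v,p)=-(\lambda,\mathbf v\cdot\mathbf n_i)_\gamma,\qquad (p,q)_{\Omega_i}+\tau b_i(\mathbf u,q)=(r,q)_{\Omega_i}\qquad\forall(\mathbf v,q)\in\mathbf V_{h,i}\times M_{h,i}.$$ Let $\mathbf u_i^*(\lambda)$ be its flux for $r=0$, and $\bar{\mathbf u}_i$ its flux for $\lambda=0$, $r=p_i^{\rm prev}+\tau f_i$. Put $s_\gamma(\lambda,\mu)=-\sum_i(\mathbf u_i^*(\lambda)\cdot\mathbf n_i,\mu)_\gamma$, $g_\gamma(\mu)=\sum_i(\bar{\mathbf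 u}_i\cdot\mathbf n_i,\mu)_\gamma$ and $\|\mu\|_{s,\gamma}=s_\gamma(\mu,\mu)^{1/2}$ on $M_{h,\gamma}$. *Reduced interface scheme.* Find $(\mathbf u,\lambda)\in\mathbf V_{h,\gamma}\times M_{h,\gamma}$ such that for all $(\mathbf v,\mu)\in\mathbf V_{h,\gamma}\times M_{h,\gamma}$ $$(\xi(\mathbf u),\mathbf v)_\gamma+a_\gamma(\mathbf u,\mathbf v)-b_\gamma(\mathbf v,\lambda)=0,$$ $$(\lambda-\lambda^{\rm prev},\mu)_\gamma+\tau b_\gamma(\mathbf u,\mu)+\tau s_\gamma(\lambda,\mu)=\tau\big((f_\gamma,\mu)_\gamma+g_\gamma(\mu)\big).\tag{1}$$ *MoLDD iteration.* Given $\mathbf u^{-1}\in\mathbf V_{h,\gamma}$ and $L_\gamma>0$, for $k=0,1,2,\dots$ find $(\mathbf u^k,\lambda^k)\in\mathbf V_{h,\gamma}\times M_{h,\gamma}$ such that $(\mathbf u^k,\lambda^k)$ satisfies (1) for all $\mu\in M_{h,\gamma}$ and $$(\xi(\mathbf u^{k-1})+L_\gamma(\mathbf u^k-\mathbf u^{k-1}),\mathbf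 v)_\gamma+a_\gamma(\mathbf u^k,\mathbf v)-b_\gamma(\mathbf v,\lambda^k)=0\qquad\forall\mathbf v\in\mathbf V_{h,\gamma}.$$ *Claim.* Let $\zeta\in[0,1)$ and $L_\gamma=L_\xi/(2(1-\zeta))$. For every $\mathbf u^{-1}\in\mathbf V_{h,\gamma}$ the MoLDD iteration defines exactly one sequence $(\mathbf u^k,\lambda^k)_{k\ge0}$. Assume in addition that one of the following holds (inequalities for $\xi'$ are meant for its quadratic form): (i) $0<\xi_m\le\xi'\le L_\xi$ everywhere; or (ii) $\xi_m=0$, $\xi'\ge0$ everywhere, and there is a constant $C_\xi$ such that $|\mathbf u^k|\le C_\xi$ a.e. on $\gamma$ for all $k\ge-1$ and $\xi'(x)\le L_\xi$ for all $|x|\le C_\xi$. Then, with $\delta_{\mathbf u}^k=\mathbf u^k-\mathbf u^{k-1}$ and $\delta_\lambda^k=\lambda^k-\lambda^{k-1}$, for all $k\ge1$ $$\|\delta_\lambda^k\|_\gamma^2+\tau\|\delta_\lambda^k\|_{s,\gamma}^2+\Big(\frac{L_\gamma}2+c_{\mathbf K,\gamma}\Big)\tau\|\delta_{\mathbf u}^k\|_\gamma^2\le\Big(\frac{L_\gamma}2-\zeta\xi_m\Big)\tau\|\delta_{\mathbf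 u}^{k-1}\|_\gamma^2,$$ where $0\le\frac{L_\gamma}2-\zeta\xi_m<\frac{L_\gamma}2+c_{\mathbf K,\gamma}$, so that this is a contraction. Moreover, the reduced interface scheme has exactly one solution $(\mathbf u,\lambda)$, and $\lambda^k\to\lambda$ in $L^2(\gamma)$ and $\mathbf u^k\to\mathbf u$ in $\mathbf H(\mathrm{div}_\tau,\gamma)$. -/

import Mathlib

open MeasureTheory Set Filter Topology
open scoped ContDiff

noncomputable section

namespace MoLDD

/-- Euclidean space `ℝⁿ`. -/
abbrev E (n : ℕ) : Type := EuclideanSpace ℝ (Fin n)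

/-- The space `L²(D; F)`, for a subset `D` of `ℝⁿ`. -/
abbrev L2 {n : ℕ} (D : Set (E n)) (F : Type) [NormedAddCommGroup F] : Type :=
  Lp F 2 (volume.restrict D)

/-! ### Geometry -/

/-- A bounded open set `Ω ⊆ ℝ^(m+1)` that a flat fracture divides into two open subdomains
`sub 0` and `sub 1`. The fracture lies in the hyperplane `range ι`, where `ι` is an affine
isometry of `ℝᵐ` into `ℝ^(m+1)`; it is the image under `ι` of the open set `γ ⊆ ℝᵐ`, so that
tangential vectors, tangential derivatives and the surface measure of the fracture are the vectors,
derivatives and the Lebesgue measure of `ℝᵐ`. -/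
structure Geometry (m : ℕ) where
  Ω : Set (E (m + 1))
  sub : Fin 2 → Set (E (m + 1))
  γ : Set (E m)
  ι : E m →ᵃⁱ[ℝ] E (m + 1)
  isOpen_Ω : IsOpen Ω
  isBounded_Ω : Bornology.IsBounded Ω
  isOpen_sub : ∀ i, IsOpen (sub i)
  isOpen_γ : IsOpen γ
  disjoint_sub : Disjoint (sub 0) (sub 1)
  union_eq : sub 0 ∪ sub 1 ∪ ι '' γ = Ω
  interface_eq : frontier (sub 0) ∩ frontier (sub 1) ∩ Ω = ι '' γ

/-! ### Meshes, lowest-order Raviart-Thomas-Nédélec and piecewise constant spaces -/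

/-- A mesh element in `ℝⁿ`: a nondegenerate simplex, or a rectangle (box) with positive side
lengths `ℓ`, placed in `ℝⁿ` by an isometry `e`. -/
inductive Elem (n : ℕ) : Type
  | simplex (S : Affine.Simplex ℝ (E n) n) : Elem n
  | box (e : E n ≃ᵃⁱ[ℝ] E n) (ℓ : Fin n → ℝ) (hℓ : ∀ i, 0 < ℓ i) : Elem n

/-- The closed set that an element occupies. -/
def Elem.carrier {n : ℕ} : Elem n → Set (E n)
  | .simplex S => convexHull ℝ (range S.points)
  | .box e ℓ _ => e '' {x : E n | ∀ i, 0 ≤ x i ∧ x i ≤ ℓ i}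

/-- Whether the element is a simplex (as opposed to a rectangle). -/
def Elem.IsSimplex {n : ℕ} : Elem n → Prop
  | .simplex _ => True
  | .box _ _ _ => False

/-- The fields `x ↦ a + b x` (`a ∈ ℝⁿ`, `b ∈ ℝ`): the lowest-order Raviart-Thomas-Nédélec
polynomials on a simplex. -/
def rtSimplex (n : ℕ) : Submodule ℝ (E n → E n) where
  carrier := {r | ∃ (a : E n) (b : ℝ), r = fun x => a + b • x}
  zero_mem' := ⟨0, 0, by ext; simp⟩
  add_mem' := by
    rintro _ _ ⟨a, b, rfl⟩ ⟨a', b', rfl⟩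
    refine ⟨a + a', b + b', ?_⟩
    funext x
    simp only [Pi.add_apply, add_smul]
    abel
  smul_mem' := by
    rintro c _ ⟨a, b, rfl⟩
    refine ⟨c • a, c * b, ?_⟩
    funext x
    simp only [Pi.smul_apply, smul_add, mul_smul]

/-- The lowest-order Raviart-Thomas-Nédélec polynomials on a rectangle: in the orthonormal frame
of the rectangle, the `i`-th component is `aᵢ + bᵢ xᵢ`. -/
def rtBox {n : ℕ} (e : E n ≃ᵃⁱ[ℝ] E n) : Submodule ℝ (E n → E n) where
  carrier := {r | ∃ a b : Fin n → ℝ, r = fun x =>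
    e.linearIsometryEquiv (WithLp.toLp 2 fun i => a i + b i * (e.symm x) i)}
  zero_mem' := ⟨0, 0, by
    funext x
    have : (WithLp.toLp 2 fun i : Fin n =>
        (0 : Fin n → ℝ) i + (0 : Fin n → ℝ) i * (e.symm x) i) = (0 : E n) := by
      ext i; simp
    rw [this, map_zero]; rfl⟩
  add_mem' := by
    rintro _ _ ⟨a, b, rfl⟩ ⟨a', b', rfl⟩
    refine ⟨a + a', b + b', ?_⟩
    funext x
    rw [Pi.add_apply, ← map_add]
    congr 1
    ext i
    simp
    ring
  smul_mem' := by
    rintro c _ ⟨a, b, rfl⟩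
    refine ⟨c • a, c • b, ?_⟩
    funext x
    rw [Pi.smul_apply, ← map_smul]
    congr 1
    ext i
    simp
    ring

/-- The local Raviart-Thomas-Nédélec space of an element. -/
def Elem.rt {n : ℕ} : Elem n → Submodule ℝ (E n → E n)
  | .simplex _ => rtSimplex n
  | .box e _ _ => rtBox e

/-- The constant functions. -/
def constants (n : ℕ) : Submodule ℝ (E n → ℝ) where
  carrier := {r | ∃ c : ℝ, r = fun _ => c}
  zero_mem' := ⟨0, rfl⟩
  add_mem' := by
    rintro _ _ ⟨a, rfl⟩ ⟨b, rfl⟩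
    exact ⟨a + b, rfl⟩
  smul_mem' := by
    rintro c _ ⟨a, rfl⟩
    exact ⟨c * a, rfl⟩

/-- A partition of `D ⊆ ℝⁿ` into finitely many closed elements, either all simplices or all
rectangles, with pairwise disjoint interiors. -/
structure Mesh {n : ℕ} (D : Set (E n)) where
  card : ℕ
  elem : Fin card → Elem n
  cover : ⋃ j, (elem j).carrier = closure D
  interior_disjoint : ∀ j k, j ≠ k →
    Disjoint (interior (elem j).carrier) (interior (elem k).carrier)
  uniform : (∀ j, (elem j).IsSimplex) ∨ (∀ j, ¬ (elem j).IsSimplex)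

/-- Conformity of a family of elements: the intersection of any two of them is a (possibly empty)
face of both. (The faces of a polytope are its exposed subsets.) -/
def Conforming {n : ℕ} {J : Type} (K : J → Elem n) : Prop :=
  ∀ j k, IsExposed ℝ (K j).carrier ((K j).carrier ∩ (K k).carrier)

/-- The functions in `L²(D; F)` that on every element `K` of the mesh agree with a member of the
local space `loc K`. -/
def Mesh.piecewise {n : ℕ} {D : Set (E n)} (T : Mesh D) {F : Type} [NormedAddCommGroup F]
    [NormedSpace ℝ F] (loc : Elem n → Submodule ℝ (E n → F)) : Submodule ℝ (L2 D F) where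
  carrier := {u | ∀ j, ∃ r ∈ loc (T.elem j),
    ∀ᵐ x ∂(volume.restrict D), x ∈ (T.elem j).carrier → u x = r x}
  zero_mem' := fun j => ⟨0, Submodule.zero_mem _, by
    filter_upwards [Lp.coeFn_zero F 2 (volume.restrict D)] with x hx _
    rw [hx]⟩
  add_mem' := by
    intro u v hu hv j
    obtain ⟨r, hr, h⟩ := hu j
    obtain ⟨s, hs, h'⟩ := hv j
    refine ⟨r + s, Submodule.add_mem _ hr hs, ?_⟩
    filter_upwards [h, h', Lp.coeFn_add u v] with x hx hx' hadd hxK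
    rw [hadd, Pi.add_apply, hx hxK, hx' hxK, Pi.add_apply]
  smul_mem' := by
    intro c u hu j
    obtain ⟨r, hr, h⟩ := hu j
    refine ⟨c • r, Submodule.smul_mem _ c hr, ?_⟩
    filter_upwards [h, Lp.coeFn_smul c u] with x hx hsmul hxK
    rw [hsmul, Pi.smul_apply, hx hxK, Pi.smul_apply]

/-- Meshes of the two subdomains, which together form a conforming mesh of `Ω`, and a partition
of the fracture. -/
structure Discretization {m : ℕ} (G : Geometry m) where
  mesh : ∀ i, Mesh (G.sub i)
  meshγ : Mesh G.γ
  conforming : Conforming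
    (fun p : (i : Fin 2) × Fin (mesh i).card => (mesh p.1).elem p.2)

/-! ### `H(div)` spaces -/

/-- `g` is the weak divergence of `u` in the open set `D`. -/
def IsWeakDiv {n : ℕ} (D : Set (E n)) (u : L2 D (E n)) (g : L2 D ℝ) : Prop :=
  ∀ φ : E n → ℝ, ContDiff ℝ ∞ φ → HasCompactSupport φ → tsupport φ ⊆ D →
    ∫ x in D, fderiv ℝ φ x (u x) = - ∫ x in D, g x * φ x

/-- `g` is the weak divergence of `u` in the subdomain `Ωᵢ`, and `w` is the normal trace `u · nᵢ`
on the fracture with respect to the outward unit normal `nᵢ` of `Ωᵢ`, both in the sense of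
Green's formula `(u, ∇φ) + (div u, φ) = (u · nᵢ, φ)_γ` for all test functions `φ` on `Ω`. -/
def IsDivWithTrace {m : ℕ} (G : Geometry m) (i : Fin 2)
    (u : L2 (G.sub i) (E (m + 1))) (g : L2 (G.sub i) ℝ) (w : L2 G.γ ℝ) : Prop :=
  ∀ φ : E (m + 1) → ℝ, ContDiff ℝ ∞ φ → HasCompactSupport φ → tsupport φ ⊆ G.Ω →
    (∫ x in G.sub i, fderiv ℝ φ x (u x)) + ∫ x in G.sub i, g x * φ x
      = ∫ y in G.γ, w y * φ (G.ι y)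

lemma integrable_fderiv_apply {n : ℕ} {D : Set (E n)} (u : L2 D (E n)) {φ : E n → ℝ}
    (hφ : ContDiff ℝ ∞ φ) (hc : HasCompactSupport φ) :
    Integrable (fun x => fderiv ℝ φ x (u x)) (volume.restrict D) := by
  have hcont : Continuous (fderiv ℝ φ) := hφ.continuous_fderiv (by simp)
  have hm : MemLp (fderiv ℝ φ) 2 (volume.restrict D) :=
    (hcont.memLp_of_hasCompactSupport (hc.fderiv ℝ)).mono_measure Measure.restrict_le_self
  have hb := MemLp.integrable_mul (hm.norm) ((Lp.memLp u).norm)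
  refine hb.mono ?_ ?_
  · exact (ContinuousLinearMap.apply ℝ ℝ).flip.aestronglyMeasurable_comp₂
      hm.aestronglyMeasurable (Lp.aestronglyMeasurable u)
  · refine Filter.Eventually.of_forall fun x => ?_
    simpa using (fderiv ℝ φ x).le_opNorm (u x)

lemma integrable_mul_of_memLp {n : ℕ} {D : Set (E n)} (g : L2 D ℝ) {φ : E n → ℝ}
    (hm : MemLp φ 2 (volume.restrict D)) :
    Integrable (fun x => g x * φ x) (volume.restrict D) :=
  MemLp.integrable_mul (Lp.memLp g) hm

lemma integral_fderiv_add {n : ℕ} {D : Set (E n)} (u v : L2 D (E n)) {φ : E n → ℝ}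
    (hφ : ContDiff ℝ ∞ φ) (hc : HasCompactSupport φ) :
    ∫ x in D, fderiv ℝ φ x ((u + v : L2 D (E n)) x) =
      (∫ x in D, fderiv ℝ φ x (u x)) + ∫ x in D, fderiv ℝ φ x (v x) := by
  rw [← integral_add (integrable_fderiv_apply u hφ hc) (integrable_fderiv_apply v hφ hc)]
  refine integral_congr_ae ?_
  filter_upwards [Lp.coeFn_add u v] with x hx
  rw [hx, Pi.add_apply, map_add]

lemma integral_fderiv_smul {n : ℕ} {D : Set (E n)} (c : ℝ) (u : L2 D (E n)) (φ : E n → ℝ) :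
    ∫ x in D, fderiv ℝ φ x ((c • u : L2 D (E n)) x) = c * ∫ x in D, fderiv ℝ φ x (u x) := by
  rw [← integral_const_mul]
  refine integral_congr_ae ?_
  filter_upwards [Lp.coeFn_smul c u] with x hx
  rw [hx, Pi.smul_apply, map_smul, smul_eq_mul]

lemma integral_fderiv_zero {n : ℕ} {D : Set (E n)} (φ : E n → ℝ) :
    ∫ x in D, fderiv ℝ φ x ((0 : L2 D (E n)) x) = 0 := by
  simpa using integral_fderiv_smul (D := D) 0 0 φ

lemma integral_mul_add {n : ℕ} {D : Set (E n)} (g h : L2 D ℝ) {φ : E n → ℝ}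
    (hm : MemLp φ 2 (volume.restrict D)) :
    ∫ x in D, (g + h : L2 D ℝ) x * φ x = (∫ x in D, g x * φ x) + ∫ x in D, h x * φ x := by
  rw [← integral_add (integrable_mul_of_memLp g hm) (integrable_mul_of_memLp h hm)]
  refine integral_congr_ae ?_
  filter_upwards [Lp.coeFn_add g h] with x hx
  rw [hx, Pi.add_apply, add_mul]

lemma integral_mul_smul {n : ℕ} {D : Set (E n)} (c : ℝ) (g : L2 D ℝ) (φ : E n → ℝ) :
    ∫ x in D, (c • g : L2 D ℝ) x * φ x = c * ∫ x in D, g x * φ x := by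
  rw [← integral_const_mul]
  refine integral_congr_ae ?_
  filter_upwards [Lp.coeFn_smul c g] with x hx
  rw [hx, Pi.smul_apply, smul_eq_mul, mul_assoc]

lemma integral_mul_zero' {n : ℕ} {D : Set (E n)} (φ : E n → ℝ) :
    ∫ x in D, (0 : L2 D ℝ) x * φ x = 0 := by
  simpa using integral_mul_smul (D := D) 0 0 φ

lemma memLp_test {n : ℕ} {D : Set (E n)} {φ : E n → ℝ}
    (hφ : ContDiff ℝ ∞ φ) (hc : HasCompactSupport φ) : MemLp φ 2 (volume.restrict D) :=
  (hφ.continuous.memLp_of_hasCompactSupport hc).mono_measure Measure.restrict_le_self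

lemma memLp_test_trace {m : ℕ} (G : Geometry m) {φ : E (m + 1) → ℝ}
    (hφ : ContDiff ℝ ∞ φ) (hc : HasCompactSupport φ) :
    MemLp (fun y => φ (G.ι y)) 2 (volume.restrict G.γ) :=
  ((hφ.continuous.comp G.ι.continuous).memLp_of_hasCompactSupport
    (hc.comp_isClosedEmbedding G.ι.isometry.isClosedEmbedding)).mono_measure
      Measure.restrict_le_self

/-- `H(div, D)`, represented by its graph: the pairs `(u, div u)`. -/
def Hdiv {n : ℕ} (D : Set (E n)) : Submodule ℝ (L2 D (E n) × L2 D ℝ) where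
  carrier := {t | IsWeakDiv D t.1 t.2}
  zero_mem' := fun φ _ _ _ => by
    rw [Prod.fst_zero, Prod.snd_zero, integral_fderiv_zero, integral_mul_zero', neg_zero]
  add_mem' := fun {s t} hs ht φ hφ hc hD => by
    rw [Prod.fst_add, Prod.snd_add, integral_fderiv_add _ _ hφ hc,
      integral_mul_add _ _ (memLp_test hφ hc), hs φ hφ hc hD, ht φ hφ hc hD]
    ring
  smul_mem' := fun c t ht φ hφ hc hD => by
    rw [Prod.smul_fst, Prod.smul_snd, integral_fderiv_smul, integral_mul_smul, ht φ hφ hc hD]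
    ring

/-- The space of the `v ∈ H(div, Ωᵢ)` with `v · nᵢ ∈ L²(γ)`, represented by the triples
`(v, div v, v · nᵢ)`. -/
def HdivTrace {m : ℕ} (G : Geometry m) (i : Fin 2) :
    Submodule ℝ (L2 (G.sub i) (E (m + 1)) × L2 (G.sub i) ℝ × L2 G.γ ℝ) where
  carrier := {t | IsDivWithTrace G i t.1 t.2.1 t.2.2}
  zero_mem' := fun φ _ _ _ => by
    simp only [Prod.fst_zero, Prod.snd_zero]
    rw [integral_fderiv_zero, integral_mul_zero', integral_mul_zero' (fun y => φ (G.ι y)),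
      add_zero]
  add_mem' := fun {s t} hs ht φ hφ hc hD => by
    simp only [Prod.fst_add, Prod.snd_add]
    rw [integral_fderiv_add _ _ hφ hc, integral_mul_add _ _ (memLp_test hφ hc),
      integral_mul_add _ _ (memLp_test_trace G hφ hc), ← hs φ hφ hc hD, ← ht φ hφ hc hD]
    ring
  smul_mem' := fun c t ht φ hφ hc hD => by
    simp only [Prod.smul_fst, Prod.smul_snd]
    rw [integral_fderiv_smul, integral_mul_smul, integral_mul_smul c _ (fun y => φ (G.ι y)),
      ← ht φ hφ hc hD]
    ring

/-! ### Discrete spaces -/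

namespace Discretization

variable {m : ℕ} {G : Geometry m}

/-- `V_{h,i}`: the Raviart-Thomas-Nédélec space of the subdomain `Ωᵢ`; its elements are the
triples `(v, div v, v · nᵢ)`. -/
def V (T : Discretization G) (i : Fin 2) :
    Submodule ℝ (L2 (G.sub i) (E (m + 1)) × L2 (G.sub i) ℝ × L2 G.γ ℝ) :=
  HdivTrace G i ⊓ ((T.mesh i).piecewise Elem.rt).comap (LinearMap.fst ℝ _ _)

/-- `M_{h,i}`: the piecewise constants of the subdomain `Ωᵢ`. -/
def M (T : Discretization G) (i : Fin 2) : Submodule ℝ (L2 (G.sub i) ℝ) :=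
  (T.mesh i).piecewise fun _ => constants (m + 1)

/-- `V_{h,γ}`: the Raviart-Thomas-Nédélec space of the fracture; its elements are the pairs
`(v, div_τ v)`, with the topology of `H(div_τ, γ)`. -/
def Vγ (T : Discretization G) : Submodule ℝ (L2 G.γ (E m) × L2 G.γ ℝ) :=
  Hdiv G.γ ⊓ (T.meshγ.piecewise Elem.rt).comap (LinearMap.fst ℝ _ _)

/-- `M_{h,γ}`: the piecewise constants of the fracture. -/
def Mγ (T : Discretization G) : Submodule ℝ (L2 G.γ ℝ) :=
  T.meshγ.piecewise fun _ => constants m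

end Discretization

/-! ### Data of one time step, and forms -/

/-- The data of one backward Euler step: the permeability tensors `K` and `Kγ`, the Robin
parameter `α`, the nonlinear flow law `ξ`, the time step `τ`, the source terms `f` and `fγ` on the
current time interval, and the pressures `pPrev` (in the subdomains) and `lamPrev` (in the
fracture) at the previous time level. -/
structure Data {m : ℕ} (G : Geometry m) where
  K : E (m + 1) → Matrix (Fin (m + 1)) (Fin (m + 1)) ℝ
  Kγ : E m → Matrix (Fin m) (Fin m) ℝ
  α : ℝ
  ξ : E m → E m
  τ : ℝ
  f : ∀ i, L2 (G.sub i) ℝ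
  fγ : L2 G.γ ℝ
  pPrev : ∀ i, L2 (G.sub i) ℝ
  lamPrev : L2 G.γ ℝ

/-- The tensor field `K` is measurable on `D`, and its inverse is uniformly elliptic with lower
bound `c > 0` and bounded by `C`. -/
def IsElliptic {n : ℕ} (D : Set (E n)) (K : E n → Matrix (Fin n) (Fin n) ℝ) (c C : ℝ) : Prop :=
  (∀ i j, AEMeasurable (fun x => K x i j) (volume.restrict D)) ∧ 0 < c ∧
    ∀ᵐ x ∂(volume.restrict D), ∀ z : E n,
      c * ‖z‖ ^ 2 ≤ inner ℝ z (Matrix.toEuclideanLin (K x)⁻¹ z) ∧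
        ‖Matrix.toEuclideanLin (K x)⁻¹ z‖ ≤ C * ‖z‖

/-- `(K⁻¹ u, v)_D`. -/
def tensorForm {n : ℕ} {D : Set (E n)} (K : E n → Matrix (Fin n) (Fin n) ℝ)
    (u v : L2 D (E n)) : ℝ :=
  ∫ x in D, inner ℝ (Matrix.toEuclideanLin (K x)⁻¹ (u x)) (v x)

section Forms

variable {m : ℕ} {G : Geometry m} (T : Discretization G) (P : Data G)

/-- `aᵢ(u, v) = (K⁻¹ u, v)_{Ωᵢ} + α⁻¹ (u · nᵢ, v · nᵢ)_γ`. -/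
def aSub (i : Fin 2) (u v : T.V i) : ℝ :=
  tensorForm P.K u.1.1 v.1.1 + P.α⁻¹ * inner ℝ u.1.2.2 v.1.2.2

/-- `bᵢ(u, q) = (div u, q)_{Ωᵢ}`. -/
def bSub (i : Fin 2) (u : T.V i) (q : T.M i) : ℝ :=
  inner ℝ u.1.2.1 (q : L2 (G.sub i) ℝ)

/-- `(u, p) ∈ V_{h,i} × M_{h,i}` solves the discrete subdomain problem with Robin data `lam` on
the fracture and right-hand side `r` in the subdomain. -/
def IsSubdomainSolution (i : Fin 2) (lam : L2 G.γ ℝ) (r : L2 (G.sub i) ℝ)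
    (s : T.V i × T.M i) : Prop :=
  (∀ v : T.V i, aSub T P i s.1 v - bSub T i v s.2 = - inner ℝ lam v.1.2.2) ∧
  (∀ q : T.M i, inner ℝ (s.2 : L2 (G.sub i) ℝ) (q : L2 (G.sub i) ℝ) + P.τ * bSub T i s.1 q
    = inner ℝ r (q : L2 (G.sub i) ℝ))

open Classical in
/-- The solution of the discrete subdomain problem (there is exactly one, the problem being a
square linear system whose homogeneous version has only the zero solution). -/
def subdomainSolution (i : Fin 2) (lam : L2 G.γ ℝ) (r : L2 (G.sub i) ℝ) : T.V i × T.M i :=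
  if h : ∃ s, IsSubdomainSolution T P i lam r s then h.choose else 0

/-- The flux `u*ᵢ(lam)` driven by the fracture pressure `lam` alone. -/
def uStar (i : Fin 2) (lam : T.Mγ) : T.V i := (subdomainSolution T P i lam 0).1

/-- The flux `ūᵢ` driven by the source term and by the previous time level alone. -/
def uBar (i : Fin 2) : T.V i := (subdomainSolution T P i 0 (P.pPrev i + P.τ • P.f i)).1

/-- The Robin-to-Neumann form `s_γ(lam, μ) = - ∑ᵢ (u*ᵢ(lam) · nᵢ, μ)_γ`. -/
def sγ (lam μ : T.Mγ) : ℝ :=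
  ∑ i, - inner ℝ (uStar T P i lam).1.2.2 (μ : L2 G.γ ℝ)

/-- The functional `g_γ(μ) = ∑ᵢ (ūᵢ · nᵢ, μ)_γ`. -/
def gγ (μ : T.Mγ) : ℝ :=
  ∑ i, inner ℝ (uBar T P i).1.2.2 (μ : L2 G.γ ℝ)

/-- The seminorm `‖μ‖_{s,γ} = s_γ(μ, μ)^{1/2}`. -/
def normS (μ : T.Mγ) : ℝ := Real.sqrt (sγ T P μ μ)

/-- `a_γ(u, v) = (K_γ⁻¹ u, v)_γ`. -/
def aγ (u v : T.Vγ) : ℝ := tensorForm P.Kγ u.1.1 v.1.1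

/-- `b_γ(u, μ) = (div_τ u, μ)_γ`. -/
def bγ (u : T.Vγ) (μ : T.Mγ) : ℝ := inner ℝ u.1.2 (μ : L2 G.γ ℝ)

/-- `(ξ(u), v)_γ`. -/
def ξForm (u v : T.Vγ) : ℝ := ∫ x in G.γ, inner ℝ (P.ξ (u.1.1 x)) (v.1.1 x)

/-- The mass conservation equation on the fracture, common to the reduced scheme and to the
iteration: `c_γ(lam - lamPrev, μ) + τ b_γ(u, μ) + τ s_γ(lam, μ) = τ ((f_γ, μ)_γ + g_γ(μ))`. -/
def MassBalance (u : T.Vγ) (lam : T.Mγ) : Prop :=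
  ∀ μ : T.Mγ,
    inner ℝ ((lam : L2 G.γ ℝ) - P.lamPrev) (μ : L2 G.γ ℝ) + P.τ * bγ T u μ
        + P.τ * sγ T P lam μ
      = P.τ * (inner ℝ P.fγ (μ : L2 G.γ ℝ) + gγ T P μ)

/-- `(u, lam)` solves the reduced nonlinear interface scheme. -/
def IsReducedSolution (u : T.Vγ) (lam : T.Mγ) : Prop :=
  (∀ v : T.Vγ, ξForm T P u v + aγ T P u v - bγ T v lam = 0) ∧ MassBalance T P u lam

/-- `(u, lam)` is the iterate that the scheme with stabilization parameter `L` computes from the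
previous flux iterate `w`. -/
def IsStep (L : ℝ) (w u : T.Vγ) (lam : T.Mγ) : Prop :=
  (∀ v : T.Vγ, ξForm T P w v + L * inner ℝ (u.1.1 - w.1.1) v.1.1 + aγ T P u v
    - bγ T v lam = 0) ∧ MassBalance T P u lam

/-- The sequences that the MoLDD iteration generates from the initial guess `u₀`. The index of the
fluxes is shifted by one: `u 0 = u₀` is the flux iterate number `-1`, and the iterate number
`k ≥ 0` is `(u (k + 1), lam k)`. -/
def IsMoLDD (L : ℝ) (u₀ : T.Vγ) (u : ℕ → T.Vγ) (lam : ℕ → T.Mγ) : Prop :=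
  u 0 = u₀ ∧ ∀ k, IsStep T P L (u k) (u (k + 1)) (lam k)

/-- The bounds on the flow law. For `m = 1` they concern the derivative `ξ'` of a scalar function;
for `m ≥ 2` a bound on `ξ'` is a bound on the quadratic form of the (symmetric) Jacobian matrix of
`ξ`, which covers scalar laws applied to each component as well as the radial laws
`u ↦ β(|u|) u` of generalized Forchheimer flow.
Either `ξm ≤ ξ' ≤ Lξ` everywhere, with `ξm > 0`; or `ξ' ≥ 0` everywhere (and then `ξm = 0`), the
fluxes are bounded by a constant `C`, and `ξ' ≤ Lξ` holds for the arguments bounded by `C`. -/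
def FlowLaw (ξm Lξ : ℝ) (u : ℕ → T.Vγ) : Prop :=
  (0 < ξm ∧ ∀ x w : E m, ξm * ‖w‖ ^ 2 ≤ inner ℝ (fderiv ℝ P.ξ x w) w ∧
      inner ℝ (fderiv ℝ P.ξ x w) w ≤ Lξ * ‖w‖ ^ 2) ∨
  (ξm = 0 ∧ (∀ x w : E m, 0 ≤ inner ℝ (fderiv ℝ P.ξ x w) w) ∧
    ∃ C : ℝ, (∀ k, ∀ᵐ x ∂(volume.restrict G.γ), ‖(u k).1.1 x‖ ≤ C) ∧
      ∀ x w : E m, ‖x‖ ≤ C → inner ℝ (fderiv ℝ P.ξ x w) w ≤ Lξ * ‖w‖ ^ 2)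

end Forms

end MoLDD

end

/-!
# Convergence of the linearized iteration for a fractured porous medium

All discrete problems live on finite-dimensional spaces: a function that is piecewise in
finite-dimensional local spaces depends on finitely many parameters
(`Mesh.finiteDimensional_piecewise`), and a field determines its weak divergence and its normal
trace (`IsDivWithTrace.eq_zero`, `IsWeakDiv.eq_zero`). The subdomain problems and the steps of the
iteration are therefore square saddle-point systems with definite diagonal blocks, hence uniquely
solvable (`existsUnique_saddlePoint`). In particular `u*ᵢ` is linear, and testing the subdomain
problems with their own solutions shows that `s_γ` is positive semidefinite (`sγ_self_nonneg`).

For the contraction, subtract two consecutive steps and test with the increments `δu`, `δlam`. The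
terms with `b_γ` cancel, and there remains `L (δ', δu) - (Δ, δu)`, where `δ'` is the previous flux
increment and `Δ` the corresponding increment of `ξ`. Since `ξ'` is symmetric with `0 ≤ ξ' ≤ Lξ`
along the segments between the values of the two fluxes, `ξ` is cocoercive there,
`|Δ|² ≤ Lξ (Δ, δ')` (`cocoercive_of_fderiv`). With `L = Lξ / (2 (1 - ζ))` this yields
`‖L δ' - Δ‖² = L² ‖δ'‖² - 2 L (Δ, δ') + ‖Δ‖² ≤ (L² - 2 L ζ ξm) ‖δ'‖²`, and Young's inequality
concludes (`linearization_error_le`, `IsStep.contraction`).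

The contraction makes the fluxes converge in `L²(γ)`, and hence in `H(div_τ, γ)` by equivalence of
norms in finite dimension; the pressures follow (`exists_tendsto_of_contraction`). Cocoercivity also
makes `ξ` Lipschitz along the iterates and their limit, which allows passing to the limit in the
scheme (`isReducedSolution_of_tendsto`). Uniqueness for the reduced scheme only needs `ξ' ≥ 0`
(`IsReducedSolution.unique`).
-/

noncomputable section

namespace MoLDD

/-! ### The discrete spaces are finite-dimensional -/

instance finiteDimensional_rtSimplex (n : ℕ) : FiniteDimensional ℝ (rtSimplex n) := by
  let Φ : E n × ℝ →ₗ[ℝ] (E n → E n) :=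
    { toFun := fun p x => p.1 + p.2 • x
      map_add' := fun p q => by
        funext x
        simp only [Prod.fst_add, Prod.snd_add, Pi.add_apply, add_smul]
        abel
      map_smul' := fun c p => by
        funext x
        simp [mul_smul] }
  have h : rtSimplex n ≤ LinearMap.range Φ := by
    rintro _ ⟨a, b, rfl⟩
    exact ⟨(a, b), rfl⟩
  exact Submodule.finiteDimensional_of_le h

instance finiteDimensional_rtBox {n : ℕ} (e : E n ≃ᵃⁱ[ℝ] E n) :
    FiniteDimensional ℝ (rtBox e) := by
  let Φ : (Fin n → ℝ) × (Fin n → ℝ) →ₗ[ℝ] (E n → E n) :=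
    { toFun := fun p x =>
        e.linearIsometryEquiv (WithLp.toLp 2 fun i => p.1 i + p.2 i * (e.symm x) i)
      map_add' := fun p q => by
        funext x
        rw [Pi.add_apply, ← map_add]
        congr 1
        ext i
        simp
        ring
      map_smul' := fun c p => by
        funext x
        rw [Pi.smul_apply, RingHom.id_apply, ← map_smul]
        congr 1
        ext i
        simp
        ring }
  have h : rtBox e ≤ LinearMap.range Φ := by
    rintro _ ⟨a, b, rfl⟩
    exact ⟨(a, b), rfl⟩
  exact Submodule.finiteDimensional_of_le h

instance finiteDimensional_elem_rt {n : ℕ} (K : Elem n) : FiniteDimensional ℝ K.rt := by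
  cases K with
  | simplex S => exact finiteDimensional_rtSimplex n
  | box e ℓ hℓ => exact finiteDimensional_rtBox e

instance finiteDimensional_constants (n : ℕ) : FiniteDimensional ℝ (constants n) := by
  have h : constants n ≤ Submodule.span ℝ {fun _ => (1 : ℝ)} := by
    rintro _ ⟨c, rfl⟩
    exact Submodule.mem_span_singleton.2 ⟨c, by funext; simp⟩
  exact Submodule.finiteDimensional_of_le h

lemma continuous_of_mem_rt {n : ℕ} {K : Elem n} {r : E n → E n} (hr : r ∈ K.rt) :
    Continuous r := by
  cases K with
  | simplex S =>
    obtain ⟨a, b, rfl⟩ := hr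
    fun_prop
  | box e ℓ hℓ =>
    obtain ⟨a, b, rfl⟩ := hr
    have := e.symm.continuous
    fun_prop

lemma Mesh.ae_mem_elem {n : ℕ} {D : Set (E n)} (T : Mesh D) (hD : MeasurableSet D) :
    ∀ᵐ x ∂(volume.restrict D), ∃ j, x ∈ (T.elem j).carrier := by
  filter_upwards [ae_restrict_mem hD] with x hx
  have : x ∈ ⋃ j, (T.elem j).carrier := T.cover ▸ subset_closure hx
  simpa using this

/-- A function that is piecewise in finite-dimensional local spaces is determined by its finitely
many local representatives. These need not be unique, so the argument runs through the linear
relation between a function and its families of representatives. -/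
lemma Mesh.finiteDimensional_piecewise {n : ℕ} {D : Set (E n)} (T : Mesh D)
    (hD : MeasurableSet D) {F : Type} [NormedAddCommGroup F] [NormedSpace ℝ F]
    (loc : Elem n → Submodule ℝ (E n → F)) [∀ K, FiniteDimensional ℝ (loc K)] :
    FiniteDimensional ℝ (T.piecewise loc) := by
  let W : Submodule ℝ ((∀ j, loc (T.elem j)) × L2 D F) :=
    { carrier := {p | ∀ j, ∀ᵐ x ∂(volume.restrict D),
        x ∈ (T.elem j).carrier → p.2 x = (p.1 j).1 x}
      zero_mem' := fun j => by
        filter_upwards [Lp.coeFn_zero F 2 (volume.restrict D)] with x hx _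
        exact hx
      add_mem' := fun {p q} hp hq j => by
        filter_upwards [hp j, hq j, Lp.coeFn_add p.2 q.2] with x h1 h2 h3 hx
        rw [Prod.snd_add, h3, Pi.add_apply, h1 hx, h2 hx]
        rfl
      smul_mem' := fun c p hp j => by
        filter_upwards [hp j, Lp.coeFn_smul c p.2] with x h1 h3 hx
        rw [Prod.smul_snd, h3, Pi.smul_apply, h1 hx]
        rfl }
  -- The representatives determine the function, because the elements cover `D`.
  have hW : FiniteDimensional ℝ W := by
    refine FiniteDimensional.of_injective ((LinearMap.fst ℝ _ _).comp W.subtype) ?_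
    refine (injective_iff_map_eq_zero _).2 ?_
    rintro ⟨p, hp⟩ h0
    have h0' : p.1 = 0 := h0
    have h2 : p.2 = 0 := by
      refine (Lp.eq_zero_iff_ae_eq_zero).2 ?_
      filter_upwards [T.ae_mem_elem hD, ae_all_iff.2 hp] with x ⟨j, hj⟩ hx
      rw [hx j hj, h0']
      rfl
    exact Subtype.ext (Prod.ext h0' h2)
  have hle : T.piecewise loc ≤ W.map (LinearMap.snd ℝ _ _) := by
    intro u hu
    choose r hr h using hu
    exact ⟨(fun j => ⟨r j, hr j⟩, u), h, rfl⟩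
  exact Submodule.finiteDimensional_of_le hle

lemma Mesh.exists_bound_of_mem_piecewise_rt {n : ℕ} {D : Set (E n)} (T : Mesh D)
    (hD : MeasurableSet D) (hb : Bornology.IsBounded D) {u : L2 D (E n)}
    (hu : u ∈ T.piecewise Elem.rt) : ∃ C : ℝ, ∀ᵐ x ∂(volume.restrict D), ‖u x‖ ≤ C := by
  choose r hr h using hu
  have hbound : ∀ j, ∃ C, ∀ x ∈ closure D, ‖r j x‖ ≤ C := fun j =>
    hb.isCompact_closure.exists_bound_of_continuousOn (continuous_of_mem_rt (hr j)).continuousOn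
  choose C hC using hbound
  refine ⟨∑ j, |C j|, ?_⟩
  filter_upwards [ae_restrict_mem hD, T.ae_mem_elem hD, ae_all_iff.2 h] with x hxD ⟨j, hj⟩ hx
  rw [hx j hj]
  calc ‖r j x‖ ≤ |C j| := (hC j x (subset_closure hxD)).trans (le_abs_self _)
    _ ≤ ∑ j, |C j| :=
      Finset.single_le_sum (f := fun j => |C j|) (fun _ _ => abs_nonneg _) (Finset.mem_univ j)

lemma Geometry.isBounded_γ {m : ℕ} (G : Geometry m) : Bornology.IsBounded G.γ := by
  refine (G.ι.isometry.antilipschitz.isBounded_preimage G.isBounded_Ω).subset fun x hx => ?_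
  rw [mem_preimage, ← G.union_eq]
  exact Or.inr (mem_image_of_mem _ hx)

lemma Geometry.measurableSet_γ {m : ℕ} (G : Geometry m) : MeasurableSet G.γ :=
  G.isOpen_γ.measurableSet

instance Geometry.isFiniteMeasure_γ {m : ℕ} (G : Geometry m) :
    IsFiniteMeasure ((volume : Measure (E m)).restrict G.γ) :=
  ⟨by simpa using G.isBounded_γ.measure_lt_top⟩

lemma Geometry.image_γ_subset {m : ℕ} (G : Geometry m) : G.ι '' G.γ ⊆ G.Ω := by
  rw [← G.union_eq]
  exact subset_union_right

lemma Geometry.sub_subset {m : ℕ} (G : Geometry m) (i : Fin 2) : G.sub i ⊆ G.Ω := by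
  rw [← G.union_eq]
  intro x hx
  fin_cases i
  · exact Or.inl (Or.inl hx)
  · exact Or.inl (Or.inr hx)

lemma Geometry.sub_subset_union {m : ℕ} (G : Geometry m) (i : Fin 2) :
    G.sub i ⊆ G.sub 0 ∪ G.sub 1 := by
  fin_cases i
  · exact subset_union_left
  · exact subset_union_right

lemma Geometry.ι_notMem_sub {m : ℕ} (G : Geometry m) (i : Fin 2) {y : E m} (hy : y ∈ G.γ) :
    G.ι y ∉ G.sub i := by
  have h : G.ι y ∈ frontier (G.sub 0) ∩ frontier (G.sub 1) ∩ G.Ω :=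
    G.interface_eq ▸ mem_image_of_mem _ hy
  have hi : G.ι y ∈ frontier (G.sub i) := by
    fin_cases i
    · exact h.1.1
    · exact h.1.2
  rw [(G.isOpen_sub i).frontier_eq] at hi
  exact hi.2

/-- An `L²` function on an open set that is orthogonal to all test functions vanishes. -/
lemma L2.eq_zero_of_integral_test {n : ℕ} {D : Set (E n)} (hD : IsOpen D) (g : L2 D ℝ)
    (h : ∀ φ : E n → ℝ, ContDiff ℝ ∞ φ → HasCompactSupport φ → tsupport φ ⊆ D →
      ∫ x in D, g x * φ x = 0) : g = 0 := by
  refine (Lp.eq_zero_iff_ae_eq_zero).2 ?_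
  have hloc : LocallyIntegrable (g : E n → ℝ) (volume.restrict D) :=
    (Lp.memLp g).locallyIntegrable (by norm_num)
  have := hD.ae_eq_zero_of_integral_contDiff_smul_eq_zero (μ := volume.restrict D)
    (hloc.locallyIntegrableOn D) fun φ h1 h2 h3 => by
      simpa [mul_comm] using h φ h1 h2 h3
  filter_upwards [this, ae_restrict_mem hD.measurableSet] with x hx hxD
  exact hx hxD

lemma exists_contDiff_one_of_isCompact {n : ℕ} {K U : Set (E n)} (hK : IsCompact K)
    (hU : IsOpen U) (hKU : K ⊆ U) : ∃ χ : E n → ℝ, ContDiff ℝ ∞ χ ∧ HasCompactSupport χ ∧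
      tsupport χ ⊆ U ∧ ∀ x ∈ K, χ x = 1 := by
  obtain ⟨L, hL, hKL, hLU⟩ := exists_compact_between hK hU hKU
  obtain ⟨χ, h1, -, h0, h1'⟩ := exists_contMDiff_zero_iff_one_iff_of_isClosed (n := ⊤)
    (modelWithCornersSelf ℝ (E n)) (isOpen_interior (s := L)).isClosed_compl hK.isClosed
    (disjoint_compl_left_iff_subset.2 hKL)
  have hsupp : tsupport χ ⊆ L := by
    refine closure_minimal (fun x hx => ?_) hL.isClosed
    by_contra hxL
    exact hx ((h0 x).1 fun hx' => hxL (interior_subset hx'))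
  exact ⟨χ, h1.contDiff, hL.of_isClosed_subset (isClosed_tsupport χ) hsupp, hsupp.trans hLU,
    fun x hx => (h1' x).1 hx⟩

/-- Every test function on the fracture is the trace of a test function on `Ω`: compose with the
orthogonal projection to the hyperplane and cut off near the image of the support. -/
lemma Geometry.exists_test_extension {m : ℕ} (G : Geometry m) {ψ : E m → ℝ}
    (hψ : ContDiff ℝ ∞ ψ) (hc : HasCompactSupport ψ) (hs : tsupport ψ ⊆ G.γ) :
    ∃ φ : E (m + 1) → ℝ, ContDiff ℝ ∞ φ ∧ HasCompactSupport φ ∧ tsupport φ ⊆ G.Ω ∧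
      ∀ y, φ (G.ι y) = ψ y := by
  obtain ⟨χ, hχ, hχc, hχs, hχ1⟩ := exists_contDiff_one_of_isCompact
    (hc.isCompact.image G.ι.continuous) G.isOpen_Ω ((image_mono hs).trans G.image_γ_subset)
  let A : E m →L[ℝ] E (m + 1) := G.ι.linearIsometry.toContinuousLinearMap
  let π : E (m + 1) → E m := fun x => A.adjoint (x - G.ι 0)
  have hπ : ContDiff ℝ ∞ π := A.adjoint.contDiff.comp (contDiff_id.sub contDiff_const)
  have hπι : ∀ y, π (G.ι y) = y := fun y => by
    have h1 : G.ι y - G.ι 0 = A y := by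
      have := G.ι.map_vsub y 0
      rw [vsub_eq_sub, vsub_eq_sub, sub_zero] at this
      exact this.symm
    have h2 : A.adjoint (A y) = y := by
      refine ext_inner_right ℝ fun z => ?_
      rw [ContinuousLinearMap.adjoint_inner_left]
      exact G.ι.linearIsometry.inner_map_map y z
    simp only [π, h1, h2]
  refine ⟨fun x => χ x * ψ (π x), hχ.mul (hψ.comp hπ), hχc.mul_right,
    (tsupport_mul_subset_left).trans hχs, fun y => ?_⟩
  simp only [hπι]
  by_cases hy : y ∈ tsupport ψ
  · rw [hχ1 _ (mem_image_of_mem _ hy), one_mul]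
  · rw [image_eq_zero_of_notMem_tsupport hy, mul_zero]

/-- The divergence and the normal trace of a field are determined by the field. -/
lemma IsDivWithTrace.eq_zero {m : ℕ} {G : Geometry m} {i : Fin 2} {g : L2 (G.sub i) ℝ}
    {w : L2 G.γ ℝ} (h : IsDivWithTrace G i 0 g w) : g = 0 ∧ w = 0 := by
  have hg : g = 0 := by
    refine L2.eq_zero_of_integral_test (G.isOpen_sub i) g fun φ h1 h2 h3 => ?_
    have := h φ h1 h2 (h3.trans (G.sub_subset i))
    rw [integral_fderiv_zero, zero_add] at this
    rw [this]
    refine integral_eq_zero_of_ae ?_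
    filter_upwards [ae_restrict_mem G.measurableSet_γ] with y hy
    rw [image_eq_zero_of_notMem_tsupport fun hy' => G.ι_notMem_sub i hy (h3 hy'), mul_zero]
    rfl
  refine ⟨hg, L2.eq_zero_of_integral_test G.isOpen_γ w fun ψ h1 h2 h3 => ?_⟩
  obtain ⟨φ, hφ1, hφ2, hφ3, hφ⟩ := G.exists_test_extension h1 h2 h3
  have := h φ hφ1 hφ2 hφ3
  rw [integral_fderiv_zero, zero_add, hg, integral_mul_zero'] at this
  simpa [hφ] using this.symm

lemma IsWeakDiv.eq_zero {n : ℕ} {D : Set (E n)} (hD : IsOpen D) {g : L2 D ℝ}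
    (h : IsWeakDiv D 0 g) : g = 0 := by
  refine L2.eq_zero_of_integral_test hD g fun φ h1 h2 h3 => ?_
  have := h φ h1 h2 h3
  rw [integral_fderiv_zero] at this
  linarith

namespace Discretization

variable {m : ℕ} {G : Geometry m} (T : Discretization G)

instance finiteDimensional_M (i : Fin 2) : FiniteDimensional ℝ (T.M i) :=
  (T.mesh i).finiteDimensional_piecewise (G.isOpen_sub i).measurableSet _

instance finiteDimensional_Mγ : FiniteDimensional ℝ T.Mγ :=
  T.meshγ.finiteDimensional_piecewise G.measurableSet_γ _

/-- The field underlying an element `(v, div v, v · nᵢ)` of `V_{h,i}`. -/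
def fieldV (i : Fin 2) : T.V i →ₗ[ℝ] L2 (G.sub i) (E (m + 1)) :=
  (LinearMap.fst ℝ _ _).comp (T.V i).subtype

/-- The divergence on `V_{h,i}`. -/
def divV (i : Fin 2) : T.V i →ₗ[ℝ] L2 (G.sub i) ℝ :=
  (LinearMap.fst ℝ _ _).comp ((LinearMap.snd ℝ _ _).comp (T.V i).subtype)

/-- The normal trace on `V_{h,i}`. -/
def traceV (i : Fin 2) : T.V i →ₗ[ℝ] L2 G.γ ℝ :=
  (LinearMap.snd ℝ _ _).comp ((LinearMap.snd ℝ _ _).comp (T.V i).subtype)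

/-- The field underlying an element `(v, div_τ v)` of `V_{h,γ}`. -/
def fieldVγ : T.Vγ →ₗ[ℝ] L2 G.γ (E m) :=
  (LinearMap.fst ℝ _ _).comp T.Vγ.subtype

/-- The tangential divergence on `V_{h,γ}`. -/
def divVγ : T.Vγ →ₗ[ℝ] L2 G.γ ℝ :=
  (LinearMap.snd ℝ _ _).comp T.Vγ.subtype

lemma fieldV_injective (i : Fin 2) : Function.Injective (T.fieldV i) := by
  refine (injective_iff_map_eq_zero _).2 ?_
  rintro ⟨⟨v, g, w⟩, hv⟩ (rfl : v = 0)
  obtain ⟨rfl, rfl⟩ := IsDivWithTrace.eq_zero (i := i) hv.1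
  rfl

lemma fieldVγ_injective : Function.Injective T.fieldVγ := by
  refine (injective_iff_map_eq_zero _).2 ?_
  rintro ⟨⟨v, g⟩, hv⟩ (rfl : v = 0)
  obtain rfl := IsWeakDiv.eq_zero G.isOpen_γ hv.1
  rfl

instance finiteDimensional_V (i : Fin 2) : FiniteDimensional ℝ (T.V i) := by
  have := (T.mesh i).finiteDimensional_piecewise (G.isOpen_sub i).measurableSet Elem.rt
  exact FiniteDimensional.of_injective
    ((T.fieldV i).codRestrict ((T.mesh i).piecewise Elem.rt) fun v => v.2.2)
    fun _ _ h => T.fieldV_injective i (congrArg Subtype.val h)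

instance finiteDimensional_Vγ : FiniteDimensional ℝ T.Vγ := by
  have := T.meshγ.finiteDimensional_piecewise G.measurableSet_γ Elem.rt
  exact FiniteDimensional.of_injective
    (T.fieldVγ.codRestrict (T.meshγ.piecewise Elem.rt) fun v => v.2.2)
    fun _ _ h => T.fieldVγ_injective (congrArg Subtype.val h)

lemma exists_bound_fieldVγ (u : T.Vγ) :
    ∃ C : ℝ, ∀ᵐ x ∂(volume.restrict G.γ), ‖T.fieldVγ u x‖ ≤ C :=
  T.meshγ.exists_bound_of_mem_piecewise_rt G.measurableSet_γ G.isBounded_γ u.2.2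

end Discretization

/-! ### Saddle-point systems and the tensor forms -/

/-- A saddle-point system on finite-dimensional spaces with definite diagonal blocks is uniquely
solvable: it is square, and testing the homogeneous system with its solution gives
`τ A(x, x) + D(y, y) = 0`. -/
theorem existsUnique_saddlePoint {X Y : Type*} [AddCommGroup X] [Module ℝ X]
    [FiniteDimensional ℝ X] [AddCommGroup Y] [Module ℝ Y] [FiniteDimensional ℝ Y]
    (A : X →ₗ[ℝ] X →ₗ[ℝ] ℝ) (B : X →ₗ[ℝ] Y →ₗ[ℝ] ℝ) (D : Y →ₗ[ℝ] Y →ₗ[ℝ] ℝ) {τ : ℝ}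
    (hτ : 0 < τ) (hA : ∀ x ≠ 0, 0 < A x x) (hD : ∀ y ≠ 0, 0 < D y y)
    (F : X →ₗ[ℝ] ℝ) (H : Y →ₗ[ℝ] ℝ) :
    ∃! s : X × Y, (∀ v, A s.1 v - B v s.2 = F v) ∧ ∀ q, D s.2 q + τ * B s.1 q = H q := by
  let Φ : X × Y →ₗ[ℝ] Module.Dual ℝ X × Module.Dual ℝ Y :=
    (A.comp (LinearMap.fst ℝ X Y) - B.flip.comp (LinearMap.snd ℝ X Y)).prod
      (D.comp (LinearMap.snd ℝ X Y) + τ • B.comp (LinearMap.fst ℝ X Y))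
  have hinj : Function.Injective Φ := by
    refine (injective_iff_map_eq_zero _).2 ?_
    rintro ⟨x, y⟩ h
    have h1 : A x x - B x y = 0 := LinearMap.congr_fun (congrArg Prod.fst h) x
    have h2 : D y y + τ * B x y = 0 := LinearMap.congr_fun (congrArg Prod.snd h) y
    have hA' : 0 ≤ A x x := by
      by_cases hx : x = 0
      · simp [hx]
      · exact (hA x hx).le
    have hD' : 0 ≤ D y y := by
      by_cases hy : y = 0
      · simp [hy]
      · exact (hD y hy).le
    have h3 : D y y + τ * A x x = 0 := by linear_combination h2 + τ * h1
    have h4 : 0 ≤ τ * A x x := mul_nonneg hτ.le hA'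
    have hx : x = 0 := by
      by_contra hx
      have := mul_pos hτ (hA x hx)
      linarith
    have hy : y = 0 := by
      by_contra hy
      have := hD y hy
      linarith
    rw [hx, hy]
    rfl
  have hbij : Function.Bijective Φ :=
    ⟨hinj, (LinearMap.injective_iff_surjective_of_finrank_eq_finrank
      (by simp [Subspace.dual_finrank_eq])).1 hinj⟩
  have key : ∀ s : X × Y, ((∀ v, A s.1 v - B v s.2 = F v) ∧
      ∀ q, D s.2 q + τ * B s.1 q = H q) ↔ Φ s = (F, H) := fun s => by
    rw [Prod.ext_iff, LinearMap.ext_iff, LinearMap.ext_iff]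
    rfl
  simp only [key]
  exact hbij.existsUnique (F, H)

section TensorForm

variable {n : ℕ} {D : Set (E n)} {K : E n → Matrix (Fin n) (Fin n) ℝ} {c C : ℝ}

lemma IsElliptic.mono {D' : Set (E n)} (h : IsElliptic D K c C) (hD : D' ⊆ D) :
    IsElliptic D' K c C :=
  ⟨fun i j => (h.1 i j).mono_set hD, h.2.1, ae_restrict_of_ae_restrict_of_subset hD h.2.2⟩

lemma IsElliptic.memLp (h : IsElliptic D K c C) (u : L2 D (E n)) :
    MemLp (fun x => Matrix.toEuclideanLin (K x)⁻¹ (u x)) 2 (volume.restrict D) := by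
  have hK : AEMeasurable (fun x i j => K x i j) (volume.restrict D) :=
    aemeasurable_pi_iff.2 fun i => aemeasurable_pi_iff.2 fun j => h.1 i j
  have hentry : ∀ i j, Measurable fun A : Fin n → Fin n → ℝ => (Matrix.of A)⁻¹ i j := by
    intro i j
    have h1 : Continuous fun A : Fin n → Fin n → ℝ => (Matrix.of A).det :=
      Continuous.matrix_det (by exact continuous_id)
    have h2 : Continuous fun A : Fin n → Fin n → ℝ => (Matrix.of A).adjugate i j :=
      (Continuous.matrix_adjugate (by exact continuous_id)).matrix_elem i j
    simp only [Matrix.inv_def, Ring.inverse_eq_inv', Matrix.smul_apply, smul_eq_mul]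
    exact h1.measurable.inv.mul h2.measurable
  have hu : AEMeasurable (u : E n → E n) (volume.restrict D) :=
    (Lp.aestronglyMeasurable u).aemeasurable
  have hmeas : AEStronglyMeasurable (fun x => Matrix.toEuclideanLin (K x)⁻¹ (u x))
      (volume.restrict D) := by
    refine AEMeasurable.aestronglyMeasurable ?_
    refine (WithLp.measurable_toLp 2 (Fin n → ℝ)).comp_aemeasurable
      (aemeasurable_pi_iff.2 fun i => ?_)
    change AEMeasurable (fun x => ∑ j, (K x)⁻¹ i j * u x j) (volume.restrict D)
    refine Finset.aemeasurable_fun_sum _ fun j _ => ?_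
    refine AEMeasurable.mul ((hentry i j).comp_aemeasurable hK) ?_
    exact ((EuclideanSpace.proj (𝕜 := ℝ) j).continuous.measurable).comp_aemeasurable hu
  refine (Lp.memLp u).of_le_mul (c := C) hmeas ?_
  filter_upwards [h.2.2] with x hx
  exact (hx _).2

/-- The operator `u ↦ K⁻¹ u` on `L²(D)`. -/
def IsElliptic.op (h : IsElliptic D K c C) : L2 D (E n) →ₗ[ℝ] L2 D (E n) where
  toFun u := (h.memLp u).toLp _
  map_add' u v := by
    rw [← MemLp.toLp_add]
    refine (MemLp.toLp_eq_toLp_iff _ _).2 ?_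
    filter_upwards [Lp.coeFn_add u v] with x hx
    rw [hx, Pi.add_apply, map_add, Pi.add_apply]
  map_smul' a u := by
    rw [RingHom.id_apply, ← MemLp.toLp_const_smul]
    refine (MemLp.toLp_eq_toLp_iff _ _).2 ?_
    filter_upwards [Lp.coeFn_smul a u] with x hx
    rw [hx, Pi.smul_apply, map_smul, Pi.smul_apply]

lemma IsElliptic.tensorForm_eq (h : IsElliptic D K c C) (u v : L2 D (E n)) :
    tensorForm K u v = inner ℝ (h.op u) v := by
  rw [L2.inner_def]
  refine integral_congr_ae ?_
  filter_upwards [(h.memLp u).coeFn_toLp] with x hx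
  exact congrArg (inner ℝ · (v x)) hx.symm

lemma IsElliptic.le_tensorForm (h : IsElliptic D K c C) (u : L2 D (E n)) :
    c * ‖u‖ ^ 2 ≤ tensorForm K u u := by
  rw [← real_inner_self_eq_norm_sq, L2.inner_def, ← integral_const_mul]
  refine integral_mono_ae ((L2.integrable_inner u u).const_mul c) ?_ ?_
  · refine (L2.integrable_inner (𝕜 := ℝ) (h.op u) u).congr ?_
    filter_upwards [(h.memLp u).coeFn_toLp] with x hx
    exact congrArg (inner ℝ · (u x)) hx
  · filter_upwards [h.2.2] with x hx
    have := (hx (u x)).1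
    rw [real_inner_self_eq_norm_sq, real_inner_comm]
    exact this

end TensorForm

/-! ### Cocoercivity of a flow law with bounded symmetric derivative -/

section Cocoercivity

variable {H : Type*} [NormedAddCommGroup H] [InnerProductSpace ℝ H]

/-- A symmetric operator with `0 ≤ A ≤ L` satisfies `A² ≤ L A`. The proof evaluates the form of
`A` at `L z - A z`. -/
lemma norm_sq_le_of_isSymmetric {A : H →ₗ[ℝ] H} (hA : A.IsSymmetric) {L : ℝ} (hL : 0 < L)
    (h0 : ∀ z, 0 ≤ inner ℝ (A z) z) (h1 : ∀ z, inner ℝ (A z) z ≤ L * ‖z‖ ^ 2) (z : H) :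
    ‖A z‖ ^ 2 ≤ L * inner ℝ (A z) z := by
  have h2 := h0 (L • z - A z)
  have h3 := h1 (A z)
  have h4 : inner ℝ (A (A z)) z = ‖A z‖ ^ 2 := by
    rw [hA (A z) z, real_inner_self_eq_norm_sq]
  rw [map_sub, map_smul, inner_sub_left, inner_sub_right, inner_sub_right, inner_smul_left,
    inner_smul_left, inner_smul_right, inner_smul_right, h4, real_inner_self_eq_norm_sq] at h2
  simp only [conj_trivial] at h2
  have h5 : 0 ≤ L * (L * inner ℝ (A z) z - ‖A z‖ ^ 2) := by linarith
  have := nonneg_of_mul_nonneg_right h5 hL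
  linarith

lemma hasDerivAt_inner_comp_lineMap {ξ : H → H} (hξ : Differentiable ℝ ξ) (x y v : H) (t : ℝ) :
    HasDerivAt (fun t : ℝ => inner ℝ (ξ (y + t • (x - y))) v)
      (inner ℝ (fderiv ℝ ξ (y + t • (x - y)) (x - y)) v) t := by
  have h1 : HasDerivAt (fun t : ℝ => y + t • (x - y)) (x - y) t := by
    simpa using ((hasDerivAt_id t).smul_const (x - y)).const_add y
  have h2 := (hξ (y + t • (x - y))).hasFDerivAt.comp_hasDerivAt t h1
  simpa using h2.inner ℝ (hasDerivAt_const t v)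

lemma le_of_hasDerivAt_nonneg {f f' : ℝ → ℝ} (hf : ∀ t, HasDerivAt f (f' t) t)
    (h : ∀ t ∈ Icc (0 : ℝ) 1, 0 ≤ f' t) : f 0 ≤ f 1 := by
  refine monotoneOn_of_deriv_nonneg (convex_Icc 0 1)
    (fun t _ => (hf t).continuousAt.continuousWithinAt)
    (fun t _ => (hf t).differentiableAt.differentiableWithinAt) (fun t ht => ?_)
    (left_mem_Icc.2 zero_le_one) (right_mem_Icc.2 zero_le_one) zero_le_one
  rw [(hf t).deriv]
  exact h t (interior_subset ht)

lemma strongly_monotone_of_fderiv {ξ : H → H} (hξ : Differentiable ℝ ξ) {μ : ℝ}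
    (h : ∀ x w, μ * ‖w‖ ^ 2 ≤ inner ℝ (fderiv ℝ ξ x w) w) (x y : H) :
    μ * ‖x - y‖ ^ 2 ≤ inner ℝ (ξ x - ξ y) (x - y) := by
  have key := le_of_hasDerivAt_nonneg
    (f := fun t => inner ℝ (ξ (y + t • (x - y))) (x - y) - t * (μ * ‖x - y‖ ^ 2))
    (fun t => (hasDerivAt_inner_comp_lineMap hξ x y (x - y) t).sub
      ((hasDerivAt_id t).mul_const _))
    (fun t _ => by have := h (y + t • (x - y)) (x - y); linarith)
  simp only [zero_smul, add_zero, one_smul, add_sub_cancel, zero_mul, one_mul, sub_zero] at key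
  rw [inner_sub_left]
  linarith

/-- Cocoercivity on a convex set where `0 ≤ ξ' ≤ L` with symmetric `ξ'`. With `v = ξ x - ξ y`,
the function `t ↦ L (ξ (xₜ), x - y) - 2 (ξ (xₜ), v) + t |v|²` along the segment `xₜ` is monotone,
because its derivative is at least `|ξ' (x - y) - v|²`. -/
lemma cocoercive_of_fderiv {ξ : H → H} (hξ : Differentiable ℝ ξ)
    (hsymm : ∀ x, (fderiv ℝ ξ x : H →ₗ[ℝ] H).IsSymmetric) {L : ℝ} (hL : 0 < L)
    (h0 : ∀ x w, 0 ≤ inner ℝ (fderiv ℝ ξ x w) w) {S : Set H} (hS : Convex ℝ S)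
    (h1 : ∀ x ∈ S, ∀ w, inner ℝ (fderiv ℝ ξ x w) w ≤ L * ‖w‖ ^ 2) {x y : H} (hx : x ∈ S)
    (hy : y ∈ S) : ‖ξ x - ξ y‖ ^ 2 ≤ L * inner ℝ (ξ x - ξ y) (x - y) := by
  set v := ξ x - ξ y with hv
  have key := le_of_hasDerivAt_nonneg
    (f := fun t => L * inner ℝ (ξ (y + t • (x - y))) (x - y)
      - 2 * inner ℝ (ξ (y + t • (x - y))) v + t * ‖v‖ ^ 2)
    (fun t => (((hasDerivAt_inner_comp_lineMap hξ x y (x - y) t).const_mul L).sub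
      ((hasDerivAt_inner_comp_lineMap hξ x y v t).const_mul 2)).add
      ((hasDerivAt_id t).mul_const _))
    (fun t ht => by
      have hmem : y + t • (x - y) ∈ S := hS.add_smul_sub_mem hy hx ht
      have h2 := norm_sq_le_of_isSymmetric (hsymm (y + t • (x - y))) hL (h0 _) (h1 _ hmem) (x - y)
      have h3 := norm_sub_sq_real (fderiv ℝ ξ (y + t • (x - y)) (x - y)) v
      have h4 := sq_nonneg ‖fderiv ℝ ξ (y + t • (x - y)) (x - y) - v‖
      simp only [ContinuousLinearMap.coe_coe] at h2
      linarith)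
  simp only [zero_smul, add_zero, one_smul, add_sub_cancel, zero_mul, one_mul] at key
  have h5 : ‖v‖ ^ 2 = inner ℝ (ξ x) v - inner ℝ (ξ y) v := by
    rw [← inner_sub_left, ← hv, real_inner_self_eq_norm_sq]
  have h6 : inner ℝ v (x - y) = inner ℝ (ξ x) (x - y) - inner ℝ (ξ y) (x - y) := by
    rw [hv, inner_sub_left]
  rw [h6]
  linarith

/-- The estimate behind the contraction: for `L = Lξ / (2 (1 - ζ))`, the error
`L δ' - Δ` of the linearization satisfies `‖L δ' - Δ‖² ≤ (L² - 2 L ζ μ) ‖δ'‖²`, and Young's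
inequality does the rest. -/
lemma linearization_error_le {L Lξ ζ μ : ℝ} (hLξ : 0 < Lξ) (hζ : ζ ∈ Ico (0 : ℝ) 1)
    (hL : L = Lξ / (2 * (1 - ζ))) {Δ δ' : H} (δ : H)
    (hco : ‖Δ‖ ^ 2 ≤ Lξ * inner ℝ Δ δ') (hmono : μ * ‖δ'‖ ^ 2 ≤ inner ℝ Δ δ') :
    L * inner ℝ δ' δ - inner ℝ Δ δ ≤ L / 2 * ‖δ‖ ^ 2 + (L / 2 - ζ * μ) * ‖δ'‖ ^ 2 := by
  have hζ1 : 0 < 1 - ζ := by linarith [hζ.2]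
  have hLpos : 0 < L := by rw [hL]; positivity
  have hLL : Lξ = 2 * L * (1 - ζ) := by rw [hL]; field_simp
  -- Young's inequality for `(L δ' - Δ, δ)` with weight `L`, as the expansion of a square.
  have h1 : 0 ≤ ‖L • δ - (L • δ' - Δ)‖ ^ 2 := sq_nonneg _
  rw [norm_sub_sq_real, norm_sub_sq_real, norm_smul, norm_smul, inner_smul_left, inner_sub_right,
    inner_smul_right, inner_smul_left, mul_pow, mul_pow, Real.norm_eq_abs, sq_abs,
    real_inner_comm Δ δ', real_inner_comm Δ δ, real_inner_comm δ' δ] at h1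
  simp only [conj_trivial] at h1
  have h2 : 0 ≤ 2 * L * ζ * (inner ℝ Δ δ' - μ * ‖δ'‖ ^ 2) :=
    mul_nonneg (by have := hζ.1; positivity) (by linarith)
  rw [hLL] at hco
  have h3 : 0 ≤ 2 * L * (L / 2 * ‖δ‖ ^ 2 + (L / 2 - ζ * μ) * ‖δ'‖ ^ 2
      - (L * inner ℝ δ' δ - inner ℝ Δ δ)) := by nlinarith
  have := nonneg_of_mul_nonneg_right h3 (by positivity)
  linarith

end Cocoercivity

/-! ### The subdomain problems and the Robin-to-Neumann form -/

section Linear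

variable {m : ℕ} {G : Geometry m} (T : Discretization G) (P : Data G) {c C : ℝ}

/-- `aᵢ` as a bilinear map. -/
def aSubₗ {i : Fin 2} (hK : IsElliptic (G.sub i) P.K c C) : T.V i →ₗ[ℝ] T.V i →ₗ[ℝ] ℝ :=
  (innerₗ _).compl₁₂ (hK.op.comp (T.fieldV i)) (T.fieldV i)
    + P.α⁻¹ • (innerₗ _).compl₁₂ (T.traceV i) (T.traceV i)

/-- `bᵢ` as a bilinear map. -/
def bSubₗ (i : Fin 2) : T.V i →ₗ[ℝ] T.M i →ₗ[ℝ] ℝ :=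
  (innerₗ _).compl₁₂ (T.divV i) (T.M i).subtype

lemma aSubₗ_apply {i : Fin 2} (hK : IsElliptic (G.sub i) P.K c C) (u v : T.V i) :
    aSubₗ T P hK u v = aSub T P i u v := by
  rw [aSub, hK.tensorForm_eq]
  rfl

lemma bSubₗ_apply {i : Fin 2} (u : T.V i) (q : T.M i) : bSubₗ T i u q = bSub T i u q := rfl

lemma aSub_self_pos {i : Fin 2} (hK : IsElliptic (G.sub i) P.K c C) (hα : 0 < P.α) {u : T.V i}
    (hu : u ≠ 0) : 0 < aSub T P i u u := by
  have h1 : 0 < ‖T.fieldV i u‖ := by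
    rw [norm_pos_iff]
    exact fun h => hu (T.fieldV_injective i (h.trans (map_zero _).symm))
  have h2 : 0 < c * ‖T.fieldV i u‖ ^ 2 := mul_pos hK.2.1 (by positivity)
  exact add_pos_of_pos_of_nonneg (h2.trans_le (hK.le_tensorForm _))
    (mul_nonneg (inv_pos.2 hα).le real_inner_self_nonneg)

theorem existsUnique_isSubdomainSolution {i : Fin 2} (hK : IsElliptic (G.sub i) P.K c C)
    (hα : 0 < P.α) (hτ : 0 < P.τ) (lam : L2 G.γ ℝ) (r : L2 (G.sub i) ℝ) :
    ∃! s, IsSubdomainSolution T P i lam r s := by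
  have key := existsUnique_saddlePoint (aSubₗ T P hK) (bSubₗ T i) (innerₗ (T.M i)) hτ
    (fun u hu => by rw [aSubₗ_apply]; exact aSub_self_pos T P hK hα hu)
    (fun q hq => real_inner_self_pos.2 hq)
    (-(innerₗ _ lam).comp (T.traceV i)) ((innerₗ _ r).comp (T.M i).subtype)
  simp only [aSubₗ_apply] at key
  exact key

lemma isSubdomainSolution_subdomainSolution {i : Fin 2} (hK : IsElliptic (G.sub i) P.K c C)
    (hα : 0 < P.α) (hτ : 0 < P.τ) (lam : L2 G.γ ℝ) (r : L2 (G.sub i) ℝ) :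
    IsSubdomainSolution T P i lam r (subdomainSolution T P i lam r) := by
  have h := (existsUnique_isSubdomainSolution T P hK hα hτ lam r).exists
  rw [subdomainSolution, dif_pos h]
  exact h.choose_spec

lemma IsSubdomainSolution.add {i : Fin 2} (hK : IsElliptic (G.sub i) P.K c C)
    {lam mu : L2 G.γ ℝ} {r q : L2 (G.sub i) ℝ} {s t : T.V i × T.M i}
    (hs : IsSubdomainSolution T P i lam r s) (ht : IsSubdomainSolution T P i mu q t) :
    IsSubdomainSolution T P i (lam + mu) (r + q) (s + t) := by
  refine ⟨fun v => ?_, fun v => ?_⟩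
  · have h1 := hs.1 v
    have h2 := ht.1 v
    rw [← aSubₗ_apply T P hK, ← bSubₗ_apply] at h1 h2 ⊢
    rw [Prod.fst_add, Prod.snd_add, map_add, map_add, LinearMap.add_apply, inner_add_left]
    linarith
  · have h1 := hs.2 v
    have h2 := ht.2 v
    rw [← bSubₗ_apply] at h1 h2 ⊢
    rw [Prod.fst_add, Prod.snd_add, map_add, LinearMap.add_apply, inner_add_left,
      Submodule.coe_add, inner_add_left]
    linarith

lemma IsSubdomainSolution.smul {i : Fin 2} (hK : IsElliptic (G.sub i) P.K c C)
    {lam : L2 G.γ ℝ} {r : L2 (G.sub i) ℝ} {s : T.V i × T.M i} (a : ℝ)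
    (hs : IsSubdomainSolution T P i lam r s) :
    IsSubdomainSolution T P i (a • lam) (a • r) (a • s) := by
  refine ⟨fun v => ?_, fun v => ?_⟩
  · have h1 := hs.1 v
    rw [← aSubₗ_apply T P hK, ← bSubₗ_apply] at h1 ⊢
    rw [Prod.smul_fst, Prod.smul_snd, map_smul, map_smul, LinearMap.smul_apply,
      real_inner_smul_left, smul_eq_mul, smul_eq_mul]
    linear_combination a * h1
  · have h1 := hs.2 v
    rw [← bSubₗ_apply] at h1 ⊢
    rw [Prod.smul_fst, Prod.smul_snd, map_smul, LinearMap.smul_apply, real_inner_smul_left,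
      Submodule.coe_smul, real_inner_smul_left, smul_eq_mul]
    linear_combination a * h1

/-- The flux `u*ᵢ` as a linear map of the fracture pressure. -/
def uStarₗ {i : Fin 2} (hK : IsElliptic (G.sub i) P.K c C) (hα : 0 < P.α) (hτ : 0 < P.τ) :
    T.Mγ →ₗ[ℝ] T.V i where
  toFun := uStar T P i
  map_add' lam mu := by
    have h := (isSubdomainSolution_subdomainSolution T P hK hα hτ lam 0).add T P hK
      (isSubdomainSolution_subdomainSolution T P hK hα hτ mu 0)
    rw [add_zero] at h
    exact congrArg Prod.fst ((existsUnique_isSubdomainSolution T P hK hα hτ _ 0).unique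
      (isSubdomainSolution_subdomainSolution T P hK hα hτ _ 0) h)
  map_smul' a lam := by
    have h := (isSubdomainSolution_subdomainSolution T P hK hα hτ lam 0).smul T P hK a
    rw [smul_zero] at h
    exact congrArg Prod.fst ((existsUnique_isSubdomainSolution T P hK hα hτ _ 0).unique
      (isSubdomainSolution_subdomainSolution T P hK hα hτ _ 0) h)

variable {P} in
/-- `s_γ` as a bilinear map. -/
def sγₗ (hK : ∀ i, IsElliptic (G.sub i) P.K c C) (hα : 0 < P.α) (hτ : 0 < P.τ) :
    T.Mγ →ₗ[ℝ] T.Mγ →ₗ[ℝ] ℝ :=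
  ∑ i, -(innerₗ _).compl₁₂ ((T.traceV i).comp (uStarₗ T P (hK i) hα hτ)) T.Mγ.subtype

lemma sγₗ_apply (hK : ∀ i, IsElliptic (G.sub i) P.K c C) (hα : 0 < P.α) (hτ : 0 < P.τ)
    (lam mu : T.Mγ) : sγₗ T hK hα hτ lam mu = sγ T P lam mu := by
  simp only [sγₗ, LinearMap.sum_apply, LinearMap.neg_apply]
  rfl

/-- Testing the subdomain problems with their solutions `(u*ᵢ, p*ᵢ)` gives
`s_γ(lam, lam) = ∑ᵢ (aᵢ(u*ᵢ, u*ᵢ) + τ⁻¹ ‖p*ᵢ‖²)`. -/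
lemma sγ_self_nonneg (hK : ∀ i, IsElliptic (G.sub i) P.K c C) (hα : 0 < P.α) (hτ : 0 < P.τ)
    (lam : T.Mγ) : 0 ≤ sγ T P lam lam := by
  refine Finset.sum_nonneg fun i _ => ?_
  obtain ⟨h1, h2⟩ := isSubdomainSolution_subdomainSolution T P (hK i) hα hτ lam 0
  set s := subdomainSolution T P i lam 0 with hs
  have h3 := h1 s.1
  have h4 := h2 s.2
  rw [inner_zero_left] at h4
  have h5 : 0 ≤ aSub T P i s.1 s.1 := by
    by_cases h : s.1 = 0
    · rw [← aSubₗ_apply T P (hK i), h, map_zero]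
    · exact (aSub_self_pos T P (hK i) hα h).le
  have h6 : 0 ≤ inner ℝ (s.2 : L2 (G.sub i) ℝ) (s.2 : L2 (G.sub i) ℝ) := real_inner_self_nonneg
  have h7 : bSub T i s.1 s.2 ≤ 0 := by
    by_contra! h
    have := mul_pos hτ h
    linarith
  have h8 : (0 : ℝ) ≤ -inner ℝ (lam : L2 G.γ ℝ) s.1.1.2.2 := by linarith
  rw [real_inner_comm] at h8
  exact h8

lemma normS_sq (hK : ∀ i, IsElliptic (G.sub i) P.K c C) (hα : 0 < P.α) (hτ : 0 < P.τ)
    (lam : T.Mγ) : normS T P lam ^ 2 = sγ T P lam lam :=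
  Real.sq_sqrt (sγ_self_nonneg T P hK hα hτ lam)

/-! ### The fracture problem -/

variable {P} in
/-- `a_γ` as a bilinear map. -/
def aγₗ {cγ Cγ : ℝ} (hKγ : IsElliptic G.γ P.Kγ cγ Cγ) : T.Vγ →ₗ[ℝ] T.Vγ →ₗ[ℝ] ℝ :=
  (innerₗ _).compl₁₂ (hKγ.op.comp T.fieldVγ) T.fieldVγ

lemma aγₗ_apply {cγ Cγ : ℝ} (hKγ : IsElliptic G.γ P.Kγ cγ Cγ) (u v : T.Vγ) :
    aγₗ T hKγ u v = aγ T P u v :=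
  (hKγ.tensorForm_eq _ _).symm

/-- `b_γ` as a bilinear map. -/
def bγₗ : T.Vγ →ₗ[ℝ] T.Mγ →ₗ[ℝ] ℝ :=
  (innerₗ _).compl₁₂ T.divVγ T.Mγ.subtype

lemma memLp_flowLaw (hξ : Continuous P.ξ) (u : T.Vγ) :
    MemLp (fun x => P.ξ (T.fieldVγ u x)) 2 (volume.restrict G.γ) := by
  obtain ⟨R, hR⟩ := T.exists_bound_fieldVγ u
  obtain ⟨B, hB⟩ := (isCompact_closedBall (0 : E m) R).exists_bound_of_continuousOn
    hξ.continuousOn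
  refine MemLp.of_bound (hξ.comp_aestronglyMeasurable (Lp.aestronglyMeasurable _)) B ?_
  filter_upwards [hR] with x hx
  exact hB _ (mem_closedBall_zero_iff.2 hx)

variable {P} in
/-- The field `ξ(u)` as an element of `L²(γ)`. It is bounded because `u` is. -/
def flowLawLp (hξ : Continuous P.ξ) (u : T.Vγ) : L2 G.γ (E m) :=
  (memLp_flowLaw T P hξ u).toLp _

lemma coeFn_flowLawLp (hξ : Continuous P.ξ) (u : T.Vγ) :
    ∀ᵐ x ∂(volume.restrict G.γ), flowLawLp T hξ u x = P.ξ (T.fieldVγ u x) :=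
  (memLp_flowLaw T P hξ u).coeFn_toLp

lemma ξForm_eq (hξ : Continuous P.ξ) (u v : T.Vγ) :
    ξForm T P u v = inner ℝ (flowLawLp T hξ u) (T.fieldVγ v) := by
  rw [L2.inner_def]
  refine integral_congr_ae ?_
  filter_upwards [coeFn_flowLawLp T P hξ u] with x hx
  rw [hx]
  rfl

lemma isStep_existsUnique {cγ Cγ L : ℝ} (hK : ∀ i, IsElliptic (G.sub i) P.K c C)
    (hKγ : IsElliptic G.γ P.Kγ cγ Cγ) (hα : 0 < P.α) (hτ : 0 < P.τ) (hξ : Continuous P.ξ)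
    (hL : 0 ≤ L) (w : T.Vγ) : ∃! s : T.Vγ × T.Mγ, IsStep T P L w s.1 s.2 := by
  have key := existsUnique_saddlePoint
    (L • (innerₗ _).compl₁₂ T.fieldVγ T.fieldVγ + aγₗ T hKγ) (bγₗ T)
    (innerₗ T.Mγ + P.τ • sγₗ T hK hα hτ) hτ
    (fun u hu => by
      have h1 : 0 < ‖T.fieldVγ u‖ := by
        rw [norm_pos_iff]
        exact fun h => hu (T.fieldVγ_injective (h.trans (map_zero _).symm))
      have h2 : 0 < cγ * ‖T.fieldVγ u‖ ^ 2 := mul_pos hKγ.2.1 (by positivity)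
      have h3 : 0 < aγₗ T hKγ u u := by
        rw [aγₗ_apply]
        exact h2.trans_le (hKγ.le_tensorForm _)
      exact add_pos_of_nonneg_of_pos (mul_nonneg hL (real_inner_self_nonneg (x := T.fieldVγ u))) h3)
    (fun μ hμ => add_pos_of_pos_of_nonneg (real_inner_self_pos.2 hμ)
      (mul_nonneg hτ.le (by rw [sγₗ_apply]; exact sγ_self_nonneg T P hK hα hτ μ)))
    ((innerₗ _ (L • T.fieldVγ w - flowLawLp T hξ w)).comp T.fieldVγ)
    ((innerₗ _ (P.lamPrev + P.τ • (P.fγ + ∑ i, T.traceV i (uBar T P i)))).comp T.Mγ.subtype)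
  refine (existsUnique_congr fun s => ?_).1 key
  refine and_congr (forall_congr' fun v => ?_) (forall_congr' fun μ => ?_)
  · rw [LinearMap.add_apply, LinearMap.add_apply, aγₗ_apply, ξForm_eq T P hξ]
    change L * inner ℝ (T.fieldVγ s.1) (T.fieldVγ v) + _ - bγ T v s.2
      = inner ℝ (L • T.fieldVγ w - flowLawLp T hξ w) (T.fieldVγ v) ↔
      _ + L * inner ℝ (T.fieldVγ s.1 - T.fieldVγ w) (T.fieldVγ v) + _ - _ = 0
    rw [inner_sub_left, inner_sub_left, real_inner_smul_left]
    constructor <;> intro h <;> linarith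
  · rw [LinearMap.add_apply, LinearMap.add_apply, LinearMap.smul_apply, LinearMap.smul_apply,
      sγₗ_apply]
    change inner ℝ (s.2 : L2 G.γ ℝ) (μ : L2 G.γ ℝ) + P.τ * sγ T P s.2 μ + P.τ * bγ T s.1 μ
      = inner ℝ (P.lamPrev + P.τ • (P.fγ + ∑ i, T.traceV i (uBar T P i))) (μ : L2 G.γ ℝ) ↔ _
    have h : gγ T P μ = inner ℝ (∑ i, T.traceV i (uBar T P i)) (μ : L2 G.γ ℝ) :=
      (sum_inner _ _ _).symm
    rw [h, inner_sub_left, inner_add_left, real_inner_smul_left, inner_add_left]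
    constructor <;> intro h <;> linarith

lemma isMoLDD_existsUnique {L : ℝ}
    (h : ∀ w : T.Vγ, ∃! s : T.Vγ × T.Mγ, IsStep T P L w s.1 s.2) (u₀ : T.Vγ) :
    ∃! s : (ℕ → T.Vγ) × (ℕ → T.Mγ), IsMoLDD T P L u₀ s.1 s.2 := by
  choose step hstep huniq using h
  let u : ℕ → T.Vγ := fun k => Nat.rec u₀ (fun _ w => (step w).1) k
  refine ⟨(u, fun k => (step (u k)).2), ⟨rfl, fun k => hstep (u k)⟩, ?_⟩
  rintro ⟨v, μ⟩ ⟨h0, hs⟩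
  have hv : ∀ k, v k = u k := by
    intro k
    induction k with
    | zero => exact h0
    | succ k ih =>
      have := huniq (v k) (v (k + 1), μ k) (hs k)
      rw [ih] at this
      exact congrArg Prod.fst this
  refine Prod.ext (funext hv) (funext fun k => ?_)
  have := huniq (v k) (v (k + 1), μ k) (hs k)
  rw [hv k] at this
  exact congrArg Prod.snd this

end Linear

/-! ### Contraction -/

section Contraction

variable {m : ℕ} {G : Geometry m} (T : Discretization G) (P : Data G) {c C cγ Cγ : ℝ}

/-- The difference of two solutions of the mass balance solves the homogeneous equation, which is
tested here with the difference of the pressures. -/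
lemma MassBalance.sub_self (hK : ∀ i, IsElliptic (G.sub i) P.K c C) (hα : 0 < P.α)
    (hτ : 0 < P.τ) {u u' : T.Vγ} {lam lam' : T.Mγ} (h : MassBalance T P u lam)
    (h' : MassBalance T P u' lam') :
    ‖lam' - lam‖ ^ 2 + P.τ * bγ T (u' - u) (lam' - lam)
      + P.τ * sγ T P (lam' - lam) (lam' - lam) = 0 := by
  have h1 := h (lam' - lam)
  have h2 := h' (lam' - lam)
  have h3 : ‖lam' - lam‖ ^ 2 = inner ℝ ((lam' : L2 G.γ ℝ) - P.lamPrev)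
      ((lam' - lam : T.Mγ) : L2 G.γ ℝ) - inner ℝ ((lam : L2 G.γ ℝ) - P.lamPrev)
      ((lam' - lam : T.Mγ) : L2 G.γ ℝ) := by
    rw [← inner_sub_left, sub_sub_sub_cancel_right, ← Submodule.coe_sub,
      real_inner_self_eq_norm_sq]
    rfl
  have h4 : bγ T (u' - u) (lam' - lam) = bγ T u' (lam' - lam) - bγ T u (lam' - lam) :=
    inner_sub_left _ _ _
  have h5 : sγ T P (lam' - lam) (lam' - lam)
      = sγ T P lam' (lam' - lam) - sγ T P lam (lam' - lam) := by
    rw [← sγₗ_apply T P hK hα hτ, ← sγₗ_apply T P hK hα hτ, ← sγₗ_apply T P hK hα hτ,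
      map_sub (sγₗ T hK hα hτ) lam' lam, LinearMap.sub_apply]
  rw [h3, h4, h5]
  linarith

lemma aγ_sub_left (hKγ : IsElliptic G.γ P.Kγ cγ Cγ) (u u' v : T.Vγ) :
    aγ T P (u' - u) v = aγ T P u' v - aγ T P u v := by
  rw [← aγₗ_apply T P hKγ, ← aγₗ_apply T P hKγ, ← aγₗ_apply T P hKγ, map_sub,
    LinearMap.sub_apply]

lemma bγ_sub_right (v : T.Vγ) (lam lam' : T.Mγ) :
    bγ T v (lam' - lam) = bγ T v lam' - bγ T v lam :=
  inner_sub_right _ _ _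

lemma le_aγ_self (hKγ : IsElliptic G.γ P.Kγ cγ Cγ) (u : T.Vγ) :
    cγ * ‖T.fieldVγ u‖ ^ 2 ≤ aγ T P u u :=
  hKγ.le_tensorForm _

/-- Strong monotonicity of the flow law, integrated over the fracture. -/
lemma flowLawLp_strongly_monotone (hξ : Differentiable ℝ P.ξ) {μ : ℝ}
    (h : ∀ x w : E m, μ * ‖w‖ ^ 2 ≤ inner ℝ (fderiv ℝ P.ξ x w) w) (u v : T.Vγ) :
    μ * ‖T.fieldVγ u - T.fieldVγ v‖ ^ 2 ≤
      inner ℝ (flowLawLp T hξ.continuous u - flowLawLp T hξ.continuous v)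
        (T.fieldVγ u - T.fieldVγ v) := by
  rw [← real_inner_self_eq_norm_sq, L2.inner_def, L2.inner_def, ← integral_const_mul]
  refine integral_mono_ae ((L2.integrable_inner _ _).const_mul μ) (L2.integrable_inner _ _) ?_
  filter_upwards [coeFn_flowLawLp T P hξ.continuous u, coeFn_flowLawLp T P hξ.continuous v,
    Lp.coeFn_sub (T.fieldVγ u) (T.fieldVγ v),
    Lp.coeFn_sub (flowLawLp T hξ.continuous u) (flowLawLp T hξ.continuous v)] with x h1 h2 h3 h4
  rw [h3, h4, Pi.sub_apply, Pi.sub_apply, h1, h2, real_inner_self_eq_norm_sq]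
  exact strongly_monotone_of_fderiv hξ h _ _

/-- Cocoercivity of the flow law, integrated over the fracture, for fluxes with values in a convex
set on which the derivative of the flow law is bounded. -/
lemma flowLawLp_cocoercive (hξ : Differentiable ℝ P.ξ)
    (hsymm : ∀ x, (fderiv ℝ P.ξ x : E m →ₗ[ℝ] E m).IsSymmetric) {L : ℝ} (hL : 0 < L)
    (h0 : ∀ x w : E m, 0 ≤ inner ℝ (fderiv ℝ P.ξ x w) w) {S : Set (E m)} (hS : Convex ℝ S)
    (hSL : ∀ x ∈ S, ∀ w, inner ℝ (fderiv ℝ P.ξ x w) w ≤ L * ‖w‖ ^ 2) {u v : T.Vγ}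
    (hu : ∀ᵐ x ∂(volume.restrict G.γ), T.fieldVγ u x ∈ S)
    (hv : ∀ᵐ x ∂(volume.restrict G.γ), T.fieldVγ v x ∈ S) :
    ‖flowLawLp T hξ.continuous u - flowLawLp T hξ.continuous v‖ ^ 2 ≤
      L * inner ℝ (flowLawLp T hξ.continuous u - flowLawLp T hξ.continuous v)
        (T.fieldVγ u - T.fieldVγ v) := by
  rw [← real_inner_self_eq_norm_sq, L2.inner_def, L2.inner_def, ← integral_const_mul]
  refine integral_mono_ae (L2.integrable_inner _ _) ((L2.integrable_inner _ _).const_mul L) ?_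
  filter_upwards [coeFn_flowLawLp T P hξ.continuous u, coeFn_flowLawLp T P hξ.continuous v,
    Lp.coeFn_sub (T.fieldVγ u) (T.fieldVγ v),
    Lp.coeFn_sub (flowLawLp T hξ.continuous u) (flowLawLp T hξ.continuous v), hu, hv]
    with x h1 h2 h3 h4 h5 h6
  rw [h3, h4, Pi.sub_apply, Pi.sub_apply, h1, h2, real_inner_self_eq_norm_sq]
  exact cocoercive_of_fderiv hξ hsymm hL h0 hS hSL h5 h6

/-- The contraction estimate for two consecutive steps. -/
lemma IsStep.contraction (hK : ∀ i, IsElliptic (G.sub i) P.K c C)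
    (hKγ : IsElliptic G.γ P.Kγ cγ Cγ) (hα : 0 < P.α) (hτ : 0 < P.τ) (hξ : Continuous P.ξ)
    {L Lξ ζ μ : ℝ} (hLξ : 0 < Lξ) (hζ : ζ ∈ Ico (0 : ℝ) 1) (hL : L = Lξ / (2 * (1 - ζ)))
    {w w' u u' : T.Vγ} {lam lam' : T.Mγ} (h : IsStep T P L w u lam)
    (h' : IsStep T P L w' u' lam')
    (hco : ‖flowLawLp T hξ w' - flowLawLp T hξ w‖ ^ 2 ≤
      Lξ * inner ℝ (flowLawLp T hξ w' - flowLawLp T hξ w) (T.fieldVγ w' - T.fieldVγ w))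
    (hmono : μ * ‖T.fieldVγ w' - T.fieldVγ w‖ ^ 2 ≤
      inner ℝ (flowLawLp T hξ w' - flowLawLp T hξ w) (T.fieldVγ w' - T.fieldVγ w)) :
    ‖lam' - lam‖ ^ 2 + P.τ * normS T P (lam' - lam) ^ 2
        + (L / 2 + cγ) * P.τ * ‖T.fieldVγ u' - T.fieldVγ u‖ ^ 2
      ≤ (L / 2 - ζ * μ) * P.τ * ‖T.fieldVγ w' - T.fieldVγ w‖ ^ 2 := by
  have hmass := h.2.sub_self T P hK hα hτ h'.2
  have hu := h.1 (u' - u)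
  have hu' := h'.1 (u' - u)
  rw [ξForm_eq T P hξ] at hu hu'
  change inner ℝ _ (T.fieldVγ (u' - u)) + L * inner ℝ (T.fieldVγ u - T.fieldVγ w)
    (T.fieldVγ (u' - u)) + _ - _ = 0 at hu
  change inner ℝ _ (T.fieldVγ (u' - u)) + L * inner ℝ (T.fieldVγ u' - T.fieldVγ w')
    (T.fieldVγ (u' - u)) + _ - _ = 0 at hu'
  have hell := le_aγ_self T P hKγ (u' - u)
  rw [aγ_sub_left T P hKγ] at hell
  rw [bγ_sub_right] at hmass
  have hyoung := linearization_error_le hLξ hζ hL (T.fieldVγ u' - T.fieldVγ u) hco hmono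
  rw [normS_sq T P hK hα hτ]
  rw [map_sub] at hu hu' hell
  set δ := T.fieldVγ u' - T.fieldVγ u with hδ
  have e1 : inner ℝ (T.fieldVγ u' - T.fieldVγ w') δ - inner ℝ (T.fieldVγ u - T.fieldVγ w) δ
      = ‖δ‖ ^ 2 - inner ℝ (T.fieldVγ w' - T.fieldVγ w) δ := by
    rw [← real_inner_self_eq_norm_sq, ← inner_sub_left, ← inner_sub_left, hδ]
    congr 1
    abel
  have e2 := inner_sub_left (𝕜 := ℝ) (flowLawLp T hξ w') (flowLawLp T hξ w) δ
  -- The flux equation tested with `δ`; `hmass` then eliminates the terms with `bγ`.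
  have e3 : L * ‖δ‖ ^ 2 - L * inner ℝ (T.fieldVγ w' - T.fieldVγ w) δ
      + inner ℝ (flowLawLp T hξ w' - flowLawLp T hξ w) δ + cγ * ‖δ‖ ^ 2
      ≤ bγ T (u' - u) lam' - bγ T (u' - u) lam := by
    linear_combination hu' - hu + hell - L * e1 + e2
  have e4 : (L / 2 + cγ) * ‖δ‖ ^ 2 - (L / 2 - ζ * μ) * ‖T.fieldVγ w' - T.fieldVγ w‖ ^ 2
      ≤ bγ T (u' - u) lam' - bγ T (u' - u) lam := by linarith
  have e5 := mul_le_mul_of_nonneg_left e4 hτ.le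
  linarith

/-- Monotonicity of the flow law makes solutions of the reduced scheme unique. -/
lemma IsReducedSolution.unique (hK : ∀ i, IsElliptic (G.sub i) P.K c C)
    (hKγ : IsElliptic G.γ P.Kγ cγ Cγ) (hα : 0 < P.α) (hτ : 0 < P.τ)
    (hξ : Differentiable ℝ P.ξ) (h0 : ∀ x w : E m, 0 ≤ inner ℝ (fderiv ℝ P.ξ x w) w)
    {u u' : T.Vγ} {lam lam' : T.Mγ} (h : IsReducedSolution T P u lam)
    (h' : IsReducedSolution T P u' lam') : u' = u ∧ lam' = lam := by
  have hmass := h.2.sub_self T P hK hα hτ h'.2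
  have hu := h.1 (u' - u)
  have hu' := h'.1 (u' - u)
  rw [ξForm_eq T P hξ.continuous, map_sub] at hu hu'
  have hell := le_aγ_self T P hKγ (u' - u)
  rw [aγ_sub_left T P hKγ] at hell
  rw [bγ_sub_right] at hmass
  have hmono := flowLawLp_strongly_monotone T P hξ (μ := 0) (by simpa using h0) u' u
  rw [inner_sub_left, zero_mul] at hmono
  have hs := mul_nonneg hτ.le (sγ_self_nonneg T P hK hα hτ (lam' - lam))
  have e1 : cγ * ‖T.fieldVγ (u' - u)‖ ^ 2 ≤ bγ T (u' - u) lam' - bγ T (u' - u) lam := by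
    linarith
  have e2 := mul_le_mul_of_nonneg_left e1 hτ.le
  have e3 : 0 ≤ P.τ * (cγ * ‖T.fieldVγ (u' - u)‖ ^ 2) :=
    mul_nonneg hτ.le (mul_nonneg hKγ.2.1.le (sq_nonneg _))
  have e4 : ‖lam' - lam‖ ^ 2 = 0 := le_antisymm (by linarith) (sq_nonneg _)
  have e5 : P.τ * (cγ * ‖T.fieldVγ (u' - u)‖ ^ 2) = 0 :=
    le_antisymm (by linarith [sq_nonneg ‖lam' - lam‖]) e3
  have e6 : T.fieldVγ (u' - u) = 0 := by
    simpa [hτ.ne', hKγ.2.1.ne'] using e5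
  refine ⟨sub_eq_zero.1 (T.fieldVγ_injective (e6.trans (map_zero _).symm)), ?_⟩
  exact sub_eq_zero.1 (norm_eq_zero.1 (pow_eq_zero_iff two_ne_zero |>.1 e4))

end Contraction

/-! ### Convergence -/

section Convergence

lemma exists_tendsto_of_le_geometric {X : Type*} [NormedAddCommGroup X] [CompleteSpace X]
    {x : ℕ → X} {r B : ℝ} (hr : r < 1) (h : ∀ k, ‖x (k + 1) - x k‖ ≤ B * r ^ k) :
    ∃ y, Tendsto x atTop (𝓝 y) := by
  refine cauchySeq_tendsto_of_complete (cauchySeq_of_le_geometric r B hr fun k => ?_)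
  rw [dist_comm, dist_eq_norm]
  exact h k

lemma exists_geometric_bound {d : ℕ → ℝ} {a b : ℝ} (hd : ∀ k, 0 ≤ d k) (ha : 0 ≤ a) (hab : a < b)
    (h : ∀ k, b * d (k + 1) ^ 2 ≤ a * d k ^ 2) :
    ∃ r < 1, 0 ≤ r ∧ ∀ k, d k ≤ d 0 * r ^ k := by
  have hb : 0 < b := ha.trans_lt hab
  have hr0 : 0 ≤ a / b := div_nonneg ha hb.le
  refine ⟨√(a / b), ?_, Real.sqrt_nonneg _, fun k => ?_⟩
  · rw [Real.sqrt_lt' one_pos, one_pow]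
    exact (div_lt_one hb).2 hab
  · induction k with
    | zero => simp
    | succ k ih =>
      have h1 : d (k + 1) ≤ √(a / b) * d k := by
        refine le_of_sq_le_sq ?_ (mul_nonneg (Real.sqrt_nonneg _) (hd k))
        rw [mul_pow, Real.sq_sqrt hr0, div_mul_eq_mul_div, le_div_iff₀ hb]
        linarith [h k]
      calc d (k + 1) ≤ √(a / b) * d k := h1
        _ ≤ √(a / b) * (d 0 * √(a / b) ^ k) :=
          mul_le_mul_of_nonneg_left ih (Real.sqrt_nonneg _)
        _ = d 0 * √(a / b) ^ (k + 1) := by ring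

variable {m : ℕ} {G : Geometry m} (T : Discretization G) (P : Data G) {c C cγ Cγ : ℝ}

lemma continuous_fieldVγ : Continuous T.fieldVγ :=
  T.fieldVγ.continuous_of_finiteDimensional

lemma ae_mem_of_tendsto {S : Set (E m)} (hS : IsClosed S) {u : ℕ → T.Vγ} {u' : T.Vγ}
    (hu : Tendsto u atTop (𝓝 u')) (h : ∀ k, ∀ᵐ x ∂(volume.restrict G.γ), T.fieldVγ (u k) x ∈ S) :
    ∀ᵐ x ∂(volume.restrict G.γ), T.fieldVγ u' x ∈ S := by
  obtain ⟨ns, -, hns⟩ := (tendstoInMeasure_of_tendsto_Lp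
    (((continuous_fieldVγ T).tendsto u').comp hu)).exists_seq_tendsto_ae
  filter_upwards [hns, ae_all_iff.2 h] with x hx hxS
  exact hS.mem_of_tendsto hx (Eventually.of_forall fun k => hxS (ns k))

/-- A limit of the iteration solves the reduced scheme, if the flow law is continuous along the
sequence of fluxes. -/
lemma isReducedSolution_of_tendsto (hK : ∀ i, IsElliptic (G.sub i) P.K c C)
    (hKγ : IsElliptic G.γ P.Kγ cγ Cγ) (hα : 0 < P.α) (hτ : 0 < P.τ) (hξ : Continuous P.ξ)
    {L : ℝ} {u : ℕ → T.Vγ} {lam : ℕ → T.Mγ} (h : ∀ k, IsStep T P L (u k) (u (k + 1)) (lam k))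
    {u' : T.Vγ} {lam' : T.Mγ} (hu : Tendsto u atTop (𝓝 u')) (hlam : Tendsto lam atTop (𝓝 lam'))
    (hflow : Tendsto (fun k => flowLawLp T hξ (u k)) atTop (𝓝 (flowLawLp T hξ u'))) :
    IsReducedSolution T P u' lam' := by
  have hu1 : Tendsto (fun k => u (k + 1)) atTop (𝓝 u') := hu.comp (tendsto_add_atTop_nat 1)
  have hcont : ∀ {X : Type} [NormedAddCommGroup X] [NormedSpace ℝ X] [FiniteDimensional ℝ X]
      (f : X →ₗ[ℝ] ℝ) {x : ℕ → X} {y : X}, Tendsto x atTop (𝓝 y) →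
      Tendsto (fun k => f (x k)) atTop (𝓝 (f y)) := fun f _ _ hx =>
    (f.continuous_of_finiteDimensional.tendsto _).comp hx
  have hF := ((continuous_fieldVγ T).tendsto u').comp hu
  have hF1 := ((continuous_fieldVγ T).tendsto u').comp hu1
  refine ⟨fun v => ?_, fun μ => ?_⟩
  · have h1 := hflow.inner (𝕜 := ℝ) (tendsto_const_nhds (x := T.fieldVγ v))
    have h2 := ((hF1.sub hF).inner (𝕜 := ℝ) (tendsto_const_nhds (x := T.fieldVγ v))).const_mul L
    have h3 := hcont ((aγₗ T hKγ).flip v) hu1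
    have h4 := hcont (bγₗ T v) hlam
    have h5 := ((h1.add h2).add h3).sub h4
    have h6 := tendsto_nhds_unique (h5.congr fun k => ?_) (tendsto_const_nhds (x := (0 : ℝ)))
    · rw [sub_self, inner_zero_left, mul_zero, add_zero, ← ξForm_eq, LinearMap.flip_apply,
        aγₗ_apply] at h6
      exact h6
    · rw [← ξForm_eq, LinearMap.flip_apply, aγₗ_apply]
      exact (h k).1 v
  · have h1 := hcont ((innerₗ T.Mγ).flip μ) hlam
    have h2 := (hcont ((bγₗ T).flip μ) hu1).const_mul P.τ
    have h3 := (hcont ((sγₗ T hK hα hτ).flip μ) hlam).const_mul P.τ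
    have h4 := ((h1.sub (tendsto_const_nhds
      (x := inner ℝ P.lamPrev (μ : L2 G.γ ℝ)))).add h2).add h3
    have key : ∀ (v : T.Vγ) (ν : T.Mγ), (innerₗ T.Mγ).flip μ ν - inner ℝ P.lamPrev (μ : L2 G.γ ℝ)
        + P.τ * (bγₗ T).flip μ v + P.τ * (sγₗ T hK hα hτ).flip μ ν
        = inner ℝ ((ν : L2 G.γ ℝ) - P.lamPrev) (μ : L2 G.γ ℝ) + P.τ * bγ T v μ
          + P.τ * sγ T P ν μ := fun v ν => by
      rw [inner_sub_left, LinearMap.flip_apply (sγₗ T hK hα hτ), sγₗ_apply]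
      rfl
    have h5 := tendsto_nhds_unique (h4.congr fun k => ?_)
      (tendsto_const_nhds (x := P.τ * (inner ℝ P.fγ (μ : L2 G.γ ℝ) + gγ T P μ)))
    · exact (key _ _).symm.trans h5
    · exact (key _ _).trans ((h k).2 μ)

/-- The contraction estimate implies convergence: the increments of the fluxes decay geometrically
in `L²(γ)`, hence also in `H(div_τ, γ)`, since the two norms are equivalent on the
finite-dimensional space `V_{h,γ}`. -/
lemma exists_tendsto_of_contraction {a b τ : ℝ} (hτ : 0 < τ) (ha : 0 ≤ a) (hab : a < b)
    {u : ℕ → T.Vγ} {lam : ℕ → T.Mγ}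
    (h : ∀ k, ‖lam (k + 1) - lam k‖ ^ 2
        + b * τ * ‖T.fieldVγ (u (k + 2)) - T.fieldVγ (u (k + 1))‖ ^ 2
      ≤ a * τ * ‖T.fieldVγ (u (k + 1)) - T.fieldVγ (u k)‖ ^ 2) :
    (∃ u', Tendsto u atTop (𝓝 u')) ∧ ∃ lam', Tendsto lam atTop (𝓝 lam') := by
  have hb : 0 < b := ha.trans_lt hab
  have : CompleteSpace T.Vγ := FiniteDimensional.complete ℝ _
  have : CompleteSpace T.Mγ := FiniteDimensional.complete ℝ _
  set d : ℕ → ℝ := fun k => ‖T.fieldVγ (u (k + 1)) - T.fieldVγ (u k)‖ with hd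
  obtain ⟨r, hr1, hr0, hdr⟩ := exists_geometric_bound (d := d) (fun k => norm_nonneg _)
    (mul_nonneg ha hτ.le) (mul_lt_mul_of_pos_right hab hτ)
    (fun k => by linarith [h k, sq_nonneg ‖lam (k + 1) - lam k‖])
  obtain ⟨κ, -, hκ⟩ := T.fieldVγ.exists_antilipschitzWith
    (LinearMap.ker_eq_bot.2 T.fieldVγ_injective)
  refine ⟨exists_tendsto_of_le_geometric (B := κ * d 0) hr1 fun k => ?_,
    exists_tendsto_of_le_geometric (B := √(a * τ) * d 0) hr1 fun k => ?_⟩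
  · have h1 := hκ.le_mul_dist (u (k + 1)) (u k)
    rw [dist_eq_norm, dist_eq_norm] at h1
    calc ‖u (k + 1) - u k‖ ≤ κ * d k := h1
      _ ≤ κ * (d 0 * r ^ k) := mul_le_mul_of_nonneg_left (hdr k) κ.2
      _ = κ * d 0 * r ^ k := by ring
  · have h1 : ‖lam (k + 1) - lam k‖ ≤ √(a * τ) * d k := by
      refine le_of_sq_le_sq ?_ (mul_nonneg (Real.sqrt_nonneg _) (norm_nonneg _))
      rw [mul_pow, Real.sq_sqrt (mul_nonneg ha hτ.le)]
      have : 0 ≤ b * τ * ‖T.fieldVγ (u (k + 2)) - T.fieldVγ (u (k + 1))‖ ^ 2 := by positivity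
      linarith [h k]
    calc ‖lam (k + 1) - lam k‖ ≤ √(a * τ) * d k := h1
      _ ≤ √(a * τ) * (d 0 * r ^ k) := mul_le_mul_of_nonneg_left (hdr k) (Real.sqrt_nonneg _)
      _ = √(a * τ) * d 0 * r ^ k := by ring

/-- Cocoercivity makes the flow law Lipschitz along the fluxes, hence continuous. -/
lemma tendsto_flowLawLp (hξ : Continuous P.ξ) {L : ℝ} (hL : 0 < L) {u : ℕ → T.Vγ} {u' : T.Vγ}
    (hu : Tendsto u atTop (𝓝 u'))
    (hco : ∀ k, ‖flowLawLp T hξ (u k) - flowLawLp T hξ u'‖ ^ 2 ≤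
      L * inner ℝ (flowLawLp T hξ (u k) - flowLawLp T hξ u') (T.fieldVγ (u k) - T.fieldVγ u')) :
    Tendsto (fun k => flowLawLp T hξ (u k)) atTop (𝓝 (flowLawLp T hξ u')) := by
  have hF := ((continuous_fieldVγ T).tendsto u').comp hu
  refine tendsto_iff_norm_sub_tendsto_zero.2 (squeeze_zero (fun _ => norm_nonneg _) (fun k => ?_)
    (by simpa using (tendsto_iff_norm_sub_tendsto_zero.1 hF).const_mul L))
  have h1 := real_inner_le_norm (flowLawLp T hξ (u k) - flowLawLp T hξ u')
    (T.fieldVγ (u k) - T.fieldVγ u')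
  have h2 := (hco k).trans (mul_le_mul_of_nonneg_left h1 hL.le)
  by_contra! h3
  have h4 : 0 < ‖flowLawLp T hξ (u k) - flowLawLp T hξ u'‖ :=
    lt_of_le_of_lt (mul_nonneg hL.le (norm_nonneg _)) h3
  have h5 := mul_lt_mul_of_pos_left h3 h4
  linarith

/-- The two alternatives for the flow law have in common that the derivative is bounded below by
`ξm ≥ 0` everywhere and above by `Lξ` on a closed convex set in which all fluxes take their
values. -/
lemma FlowLaw.exists_convex {T : Discretization G} {P : Data G} (hm : 0 < m) {ξm Lξ : ℝ}
    (hLξ : 0 < Lξ) {u : ℕ → T.Vγ} (h : FlowLaw T P ξm Lξ u) :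
    0 ≤ ξm ∧ ξm ≤ Lξ ∧ (∀ x w : E m, ξm * ‖w‖ ^ 2 ≤ inner ℝ (fderiv ℝ P.ξ x w) w) ∧
      ∃ S : Set (E m), Convex ℝ S ∧ IsClosed S ∧
        (∀ k, ∀ᵐ x ∂(volume.restrict G.γ), T.fieldVγ (u k) x ∈ S) ∧
        ∀ x ∈ S, ∀ w, inner ℝ (fderiv ℝ P.ξ x w) w ≤ Lξ * ‖w‖ ^ 2 := by
  rcases h with ⟨hpos, hb⟩ | ⟨rfl, hb, R, hR, hL⟩
  · refine ⟨hpos.le, ?_, fun x w => (hb x w).1, univ, convex_univ, isClosed_univ,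
      fun k => Eventually.of_forall fun _ => mem_univ _, fun x _ w => (hb x w).2⟩
    have h1 := (hb 0 (EuclideanSpace.single ⟨0, hm⟩ 1)).1.trans
      (hb 0 (EuclideanSpace.single ⟨0, hm⟩ 1)).2
    simpa using h1
  · refine ⟨le_rfl, hLξ.le, by simpa using hb, Metric.closedBall 0 R, convex_closedBall 0 R,
      Metric.isClosed_closedBall, fun k => ?_, fun x hx w => hL x w (mem_closedBall_zero_iff.1 hx)⟩
    filter_upwards [hR k] with x hx
    exact mem_closedBall_zero_iff.2 hx

end Convergence

end MoLDD

end

/-! ### The convergence theorem -/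

theorem mainTheorem1 {m : ℕ} (hm : m = 1 ∨ m = 2) (G : MoLDD.Geometry m)
    (T : MoLDD.Discretization G) (P : MoLDD.Data G)
    (ξm Lξ cK CK cKγ CKγ ζ Lγ : ℝ)
    (hξ : ContDiff ℝ 1 P.ξ)
    (hξ_symm : ∀ x, (fderiv ℝ P.ξ x : MoLDD.E m →ₗ[ℝ] MoLDD.E m).IsSymmetric)
    (hLξ : 0 < Lξ)
    (hK : MoLDD.IsElliptic (G.sub 0 ∪ G.sub 1) P.K cK CK)
    (hKγ : MoLDD.IsElliptic G.γ P.Kγ cKγ CKγ)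
    (hα : 0 < P.α) (hτ : 0 < P.τ)
    (hζ : ζ ∈ Set.Ico (0 : ℝ) 1) (hLγ : Lγ = Lξ / (2 * (1 - ζ)))
    (u₀ : T.Vγ) :
    (∃! s : (ℕ → T.Vγ) × (ℕ → T.Mγ), MoLDD.IsMoLDD T P Lγ u₀ s.1 s.2) ∧
    ∀ (u : ℕ → T.Vγ) (lam : ℕ → T.Mγ), MoLDD.IsMoLDD T P Lγ u₀ u lam →
      MoLDD.FlowLaw T P ξm Lξ u →
      (∀ k : ℕ,
        ‖lam (k + 1) - lam k‖ ^ 2 + P.τ * MoLDD.normS T P (lam (k + 1) - lam k) ^ 2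
            + (Lγ / 2 + cKγ) * P.τ * ‖(u (k + 2)).1.1 - (u (k + 1)).1.1‖ ^ 2
          ≤ (Lγ / 2 - ζ * ξm) * P.τ * ‖(u (k + 1)).1.1 - (u k).1.1‖ ^ 2) ∧
      0 ≤ Lγ / 2 - ζ * ξm ∧ Lγ / 2 - ζ * ξm < Lγ / 2 + cKγ ∧
      ∃ (u' : T.Vγ) (lam' : T.Mγ),
        (MoLDD.IsReducedSolution T P u' lam' ∧
          ∀ (v : T.Vγ) (μ : T.Mγ), MoLDD.IsReducedSolution T P v μ → v = u' ∧ μ = lam') ∧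
        Filter.Tendsto lam Filter.atTop (nhds lam') ∧
        Filter.Tendsto u Filter.atTop (nhds u') := by
  have hKi : ∀ i, MoLDD.IsElliptic (G.sub i) P.K cK CK := fun i => hK.mono (G.sub_subset_union i)
  have hd : Differentiable ℝ P.ξ := hξ.differentiable (by simp)
  have hζ1 : 0 < 1 - ζ := by linarith [hζ.2]
  have hLpos : 0 < Lγ := by rw [hLγ]; positivity
  refine ⟨MoLDD.isMoLDD_existsUnique T P (MoLDD.isStep_existsUnique T P hKi hKγ hα hτ
    hd.continuous hLpos.le) u₀, fun u lam hit hflow => ?_⟩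
  obtain ⟨hξm, hξmL, hlow, S, hSconv, hSclosed, huS, hup⟩ :=
    hflow.exists_convex (by omega) hLξ
  have hlow0 : ∀ x w : MoLDD.E m, 0 ≤ inner ℝ (fderiv ℝ P.ξ x w) w := fun x w =>
    (mul_nonneg hξm (sq_nonneg _)).trans (hlow x w)
  have hcontr := fun k => (hit.2 k).contraction T P hKi hKγ hα hτ hd.continuous hLξ hζ hLγ
    (hit.2 (k + 1))
    (MoLDD.flowLawLp_cocoercive T P hd hξ_symm hLξ hlow0 hSconv hup (huS (k + 1)) (huS k))
    (MoLDD.flowLawLp_strongly_monotone T P hd hlow (u (k + 1)) (u k))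
  -- `ζ ξm ≤ ζ Lξ`, and `4 ζ (1 - ζ) ≤ 1`.
  have hnonneg : 0 ≤ Lγ / 2 - ζ * ξm := by
    have h1 : Lξ = 2 * Lγ * (1 - ζ) := by rw [hLγ]; field_simp
    have h2 : ζ * ξm ≤ ζ * Lξ := mul_le_mul_of_nonneg_left hξmL hζ.1
    have h3 : 0 ≤ Lγ * (1 - 2 * ζ) ^ 2 := by positivity
    rw [h1] at h2
    linarith
  have hlt : Lγ / 2 - ζ * ξm < Lγ / 2 + cKγ := by
    have := mul_nonneg hζ.1 hξm
    linarith [hKγ.2.1]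
  refine ⟨hcontr, hnonneg, hlt, ?_⟩
  obtain ⟨⟨u', hu'⟩, lam', hlam'⟩ := MoLDD.exists_tendsto_of_contraction T (u := u) (lam := lam)
    hτ hnonneg hlt fun k => by
      have h1 := hcontr k
      have h2 := mul_nonneg hτ.le (sq_nonneg (MoLDD.normS T P (lam (k + 1) - lam k)))
      linarith
  have hu'S := MoLDD.ae_mem_of_tendsto T hSclosed hu' huS
  have hsol : MoLDD.IsReducedSolution T P u' lam' :=
    MoLDD.isReducedSolution_of_tendsto T P hKi hKγ hα hτ hd.continuous hit.2 hu' hlam'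
      (MoLDD.tendsto_flowLawLp T P hd.continuous hLξ hu' fun k =>
        MoLDD.flowLawLp_cocoercive T P hd hξ_symm hLξ hlow0 hSconv hup (huS k) hu'S)
  exact ⟨u', lam', ⟨hsol, fun v μ h => hsol.unique T P hKi hKγ hα hτ hd hlow0 h⟩, hlam', hu'⟩
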